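/- Call a topological space \emph{orderable} if its topology is the order topology of some linear order on it, \emph{suborderable} if it is homeomorphic to a subspace of an orderable space, and \emph{locally ordered} if each of its points has a neighbourhood that is orderable in the subspace topology. Call a space \emph{loop-ordered} if it is homeomorphic to a quotient space obtained from a compact connected linearly ordered space with at least two points (carrying its order topology) by identifying the smallest and the greatest element. A \emph{locally ordered compactification} of a topological space $X$ is a compact Hausdorff locally ordered space $Y$ together with a homeomorphic embedding of $X$ onto a dense subspace of $Y$. \textbf{Theorem.} A topological space $X$ admits a locally ordered compactification if and only if $X$ is homeomorphic to a topological disjoint union $S \sqcup L_1 \sqcup \dots \sqcup L_n$ for some (possibly empty) suborderable space $S$, some integer $n \ge 0$ and some loop-ordered spaces $L_1, \dots, L_n$. -/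

import Mathlib

open Topology

universe u

/-- A topological space is orderable if its topology is the order topology of some linear order. -/
def IsOrderable (X : Type u) [TopologicalSpace X] : Prop :=
  ∃ _ : LinearOrder X, OrderTopology X

/-- A topological space is locally ordered if every point has a neighbourhood which is
orderable in the subspace topology. -/
def IsLocallyOrdered (X : Type u) [TopologicalSpace X] : Prop :=
  ∀ x : X, ∃ U ∈ 𝓝 x, IsOrderable U

/-- A topological space is suborderable (a generalised ordered space) if it is homeomorphic to a
subspace of an orderable space. -/
def IsSuborderable (X : Type u) [TopologicalSpace X] : Prop :=
  ∃ (Y : Type u) (_ : TopologicalSpace Y), IsOrderable Y ∧ ∃ f : X → Y, IsEmbedding f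

/-- The space obtained from a linearly ordered space by identifying the smallest and the greatest
element (if they exist); it carries the quotient topology. -/
abbrev EndpointQuotient (K : Type u) [LinearOrder K] : Type u :=
  Quot fun x y : K => IsBot x ∧ IsTop y

/-- A loop-ordered space is a space obtained from a compact connected linearly ordered space with
at least two points by identifying the smallest and the greatest element. -/
def IsLoopOrdered (X : Type u) [TopologicalSpace X] : Prop :=
  ∃ (K : Type u) (_ : LinearOrder K) (_ : TopologicalSpace K),
    OrderTopology K ∧ CompactSpace K ∧ ConnectedSpace K ∧ Nontrivial K ∧
      Nonempty (X ≃ₜ EndpointQuotient K)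

/-- A space admits a locally ordered compactification if it embeds densely in some compact
Hausdorff locally ordered space. -/
def HasLocallyOrderedCompactification (X : Type u) [TopologicalSpace X] : Prop :=
  ∃ (Y : Type u) (_ : TopologicalSpace Y),
    CompactSpace Y ∧ T2Space Y ∧ IsLocallyOrdered Y ∧ ∃ f : X → Y, IsDenseEmbedding f

/-!
Let `Y` be a compact Hausdorff locally ordered space. A connected component of `Y` is covered by
finitely many arcs. Two intersecting arcs either have an arc as their union or contain a loop
between them, because an arc can be left only through one of its ends; and a loop is clopen, for
the same reason. Hence a component is an arc or a loop. An ordered germ of `Y` at each end of an arc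
component turns the arc into a compact ordered neighbourhood of itself, and in a compact space such
a neighbourhood contains a clopen one. So `Y` is a finite sum of loops and orderable spaces, and a
subspace of `Y` is the sum of its traces on the summands. A trace which is not the whole loop misses
a point, and the loop cut at that point is an ordered set.

Conversely, the Dedekind completion embeds a suborderable space in a compact ordered one, and
loop-ordered spaces already are compact and locally ordered.
-/

open Set

section CompactOrderedSets

/-- A compact set `A` which meets every closed ray with endpoint in `A` in a closed set. In a
Hausdorff space this says that `A` is compact and carries the order topology of the induced order.
The order lives on the whole space so that it passes to subsets of `A` without coercions; away
from `A` it carries no information. -/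
structure IsCompactOrdered {Y : Type*} [TopologicalSpace Y] [LinearOrder Y] (A : Set Y) :
    Prop where
  isCompact : IsCompact A
  isClosed_inter_Iic : ∀ x ∈ A, IsClosed (A ∩ Iic x)
  isClosed_inter_Ici : ∀ x ∈ A, IsClosed (A ∩ Ici x)

/-- `v` is the immediate successor of `u` in the ordered set `A`. Jumps are the obstructions to
connectedness of a compact ordered set. -/
def IsJump {Y : Type*} [LinearOrder Y] (A : Set Y) (u v : Y) : Prop :=
  u ∈ A ∧ v ∈ A ∧ u < v ∧ ∀ w ∈ A, w ≤ u ∨ v ≤ w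

theorem orderTopology_of_compactSpace {K : Type*} [LinearOrder K] [t : TopologicalSpace K]
    [ClosedIicTopology K] [ClosedIciTopology K] [CompactSpace K] : OrderTopology K := by
  have hle : t ≤ Preorder.topology K := by
    refine le_generateFrom ?_
    rintro _ ⟨a, rfl | rfl⟩
    · exact isOpen_Ioi
    · exact isOpen_Iio
  have hT2 : @T2Space K (Preorder.topology K) :=
    @OrderClosedTopology.to_t2Space K (Preorder.topology K) _
      (@OrderTopology.to_orderClosedTopology K (Preorder.topology K) _
        (@OrderTopology.mk K (Preorder.topology K) _ rfl))
  have hid : @IsClosedMap K K t (Preorder.topology K) id :=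
    @Continuous.isClosedMap K K t (Preorder.topology K) _ hT2 id (continuous_id_iff_le.2 hle)
  refine ⟨le_antisymm hle fun s hs => ?_⟩
  rw [← @isClosed_compl_iff K (Preorder.topology K), ← image_id sᶜ]
  exact hid _ hs.isClosed_compl

theorem exists_linearOrder_strictMonoOn {K Z : Type*} [LinearOrder K] {A : Set K} {g : K → Z}
    (hg : InjOn g A) : ∃ _ : LinearOrder Z, StrictMonoOn g A := by
  classical
  let _ : LinearOrder Z := linearOrderOfSTO WellOrderingRel
  rcases isEmpty_or_nonempty K with _ | _
  · exact ⟨inferInstance, fun x => isEmptyElim x⟩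
  · refine ⟨LinearOrder.lift' (fun z => toLex (Function.invFunOn g A z, z))
      fun x y hxy => congrArg (fun w => (ofLex w).2) hxy, fun x hx y hy hxy => ?_⟩
    refine Prod.Lex.toLex_lt_toLex.2 (Or.inl ?_)
    rwa [hg.leftInvOn_invFunOn hx, hg.leftInvOn_invFunOn hy]

namespace IsCompactOrdered

variable {Y : Type*} [TopologicalSpace Y] [LinearOrder Y] {A B D W : Set Y} {u v x y z : Y}

theorem dual (h : IsCompactOrdered A) : IsCompactOrdered (OrderDual.ofDual ⁻¹' A) :=
  ⟨h.isCompact, h.isClosed_inter_Ici, h.isClosed_inter_Iic⟩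

theorem of_isCompact [OrderClosedTopology Y] (hA : IsCompact A) : IsCompactOrdered A :=
  ⟨hA, fun _ _ => hA.isClosed.inter isClosed_Iic, fun _ _ => hA.isClosed.inter isClosed_Ici⟩

theorem isClosed (h : IsCompactOrdered A) : IsClosed A := by
  rcases A.eq_empty_or_nonempty with rfl | ⟨x, hx⟩
  · exact isClosed_empty
  · rw [← inter_univ A, ← Iic_union_Ici (a := x), inter_union_distrib_left]
    exact (h.isClosed_inter_Iic x hx).union (h.isClosed_inter_Ici x hx)

theorem mono (h : IsCompactOrdered A) (hBA : B ⊆ A) (hB : IsClosed B) : IsCompactOrdered B where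
  isCompact := h.isCompact.of_isClosed_subset hB hBA
  isClosed_inter_Iic x hx := by
    rw [← inter_eq_left.2 hBA, inter_assoc]
    exact hB.inter (h.isClosed_inter_Iic x (hBA hx))
  isClosed_inter_Ici x hx := by
    rw [← inter_eq_left.2 hBA, inter_assoc]
    exact hB.inter (h.isClosed_inter_Ici x (hBA hx))

theorem isClosed_inter_Icc (h : IsCompactOrdered A) (hx : x ∈ A) (hy : y ∈ A) :
    IsClosed (A ∩ Icc x y) := by
  rw [← Ici_inter_Iic, inter_inter_distrib_left]
  exact (h.isClosed_inter_Ici x hx).inter (h.isClosed_inter_Iic y hy)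

theorem Ioi_mem_nhdsWithin (h : IsCompactOrdered A) (hx : x ∈ A) (hxy : x < y) :
    Ioi x ∈ 𝓝[A] y := by
  have hy : (A ∩ Iic x)ᶜ ∈ 𝓝 y :=
    (h.isClosed_inter_Iic x hx).isOpen_compl.mem_nhds fun hy => hxy.not_ge hy.2
  filter_upwards [mem_nhdsWithin_of_mem_nhds hy, self_mem_nhdsWithin] with z hz hzA
  exact not_le.1 fun hzx => hz ⟨hzA, hzx⟩

theorem Iio_mem_nhdsWithin (h : IsCompactOrdered A) (hx : x ∈ A) (hyx : y < x) :
    Iio x ∈ 𝓝[A] y :=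
  h.dual.Ioi_mem_nhdsWithin hx hyx

theorem mem_of_isPreconnected (h : IsCompactOrdered A) (hD : IsPreconnected D) (hDA : D ⊆ A)
    (hx : x ∈ D) (hy : y ∈ D) (hz : z ∈ A) (hxz : x ≤ z) (hzy : z ≤ y) : z ∈ D := by
  obtain ⟨w, hwD, ⟨-, hwz⟩, -, hzw⟩ := isPreconnected_closed_iff.1 hD _ _
    (h.isClosed_inter_Iic z hz) (h.isClosed_inter_Ici z hz)
    (fun w hw => (le_total w z).imp (⟨hDA hw, ·⟩) (⟨hDA hw, ·⟩))
    ⟨x, hx, hDA hx, hxz⟩ ⟨y, hy, hDA hy, hzy⟩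
  exact le_antisymm hwz hzw ▸ hwD

theorem not_isPreconnected_of_isJump (h : IsCompactOrdered A) (hj : IsJump A u v) (hDA : D ⊆ A)
    (hu : u ∈ D) (hv : v ∈ D) : ¬ IsPreconnected D := fun hD => by
  obtain ⟨huA, hvA, huv, hgap⟩ := hj
  obtain ⟨w, -, ⟨-, hwu⟩, -, hvw⟩ := isPreconnected_closed_iff.1 hD _ _
    (h.isClosed_inter_Iic u huA) (h.isClosed_inter_Ici v hvA)
    (fun w hw => (hgap w (hDA hw)).imp (⟨hDA hw, ·⟩) (⟨hDA hw, ·⟩))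
    ⟨u, hu, huA, le_rfl⟩ ⟨v, hv, hvA, le_rfl⟩
  exact (hvw.trans hwu).not_gt huv

theorem exists_between (h : IsCompactOrdered A) (hA : IsPreconnected A) (hx : x ∈ A) (hy : y ∈ A)
    (hxy : x < y) : ∃ z ∈ A, x < z ∧ z < y := by
  by_contra! hno
  exact h.not_isPreconnected_of_isJump
    ⟨hx, hy, hxy, fun w hw => (le_or_gt w x).imp_right (hno w hw)⟩ Subset.rfl hx hy hA

theorem orderTopology (h : IsCompactOrdered A) : OrderTopology A := by
  have := isCompact_iff_compactSpace.1 h.isCompact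
  have hIic : ClosedIicTopology A :=
    ⟨fun a => isClosed_induced_iff.2 ⟨_, h.isClosed_inter_Iic a a.2, by ext; simp⟩⟩
  have hIci : ClosedIciTopology A :=
    ⟨fun a => isClosed_induced_iff.2 ⟨_, h.isClosed_inter_Ici a a.2, by ext; simp⟩⟩
  exact orderTopology_of_compactSpace

theorem exists_isLeast (h : IsCompactOrdered A) (hBA : B ⊆ A) (hB : IsClosed B)
    (hne : B.Nonempty) : ∃ m, IsLeast B m := by
  have := (h.mono hBA hB).orderTopology
  have := isCompact_iff_compactSpace.1 (h.mono hBA hB).isCompact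
  have := hne.to_subtype
  obtain ⟨m, -, hm⟩ := (isCompact_univ (X := B)).exists_isLeast univ_nonempty
  exact ⟨m, m.2, fun x hx => hm (mem_univ ⟨x, hx⟩)⟩

theorem exists_isGreatest (h : IsCompactOrdered A) (hBA : B ⊆ A) (hB : IsClosed B)
    (hne : B.Nonempty) : ∃ m, IsGreatest B m :=
  h.dual.exists_isLeast hBA hB hne

theorem exists_Ioc_subset (h : IsCompactOrdered A) (hx : x ∈ A) (hW : W ∈ 𝓝[A] x) (hy : y ∈ A)
    (hyx : y < x) : ∃ l ∈ A, l < x ∧ A ∩ Ioc l x ⊆ W := by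
  have := h.orderTopology
  obtain ⟨l, hlx, hl⟩ := exists_Ioc_subset_of_mem_nhds
    (preimage_coe_mem_nhds_subtype (a := (⟨x, hx⟩ : A)).2 hW) ⟨⟨y, hy⟩, hyx⟩
  exact ⟨l, l.2, hlx, fun z hz => hl (show (⟨z, hz.1⟩ : A) ∈ Ioc l ⟨x, hx⟩ from hz.2)⟩

theorem exists_isJump_of_isClosed_cover {F G : Set Y} (h : IsCompactOrdered A) (hF : IsClosed F)
    (hG : IsClosed G) (hcov : A ⊆ F ∪ G) (hdisj : A ∩ (F ∩ G) = ∅) (hx : x ∈ A ∩ F)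
    (hy : y ∈ A ∩ G) (hxy : x < y) : ∃ u v, IsJump A u v := by
  obtain ⟨v, ⟨⟨hvA, hxv⟩, hvG⟩, hv⟩ := h.exists_isLeast (inter_subset_left.trans inter_subset_left)
    ((h.isClosed_inter_Ici x hx.1).inter hG) ⟨y, ⟨hy.1, hxy.le⟩, hy.2⟩
  obtain ⟨u, ⟨⟨huA, huv⟩, huF⟩, hu⟩ := h.exists_isGreatest
    (inter_subset_left.trans inter_subset_left) ((h.isClosed_inter_Iic v hvA).inter hF)
    ⟨x, ⟨hx.1, hxv⟩, hx.2⟩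
  have hne : u ≠ v := by
    rintro rfl
    exact hdisj.subset ⟨huA, huF, hvG⟩
  refine ⟨u, v, huA, hvA, lt_of_le_of_ne huv hne, fun w hw => ?_⟩
  by_contra! huwv
  rcases hcov hw with hwF | hwG
  · exact huwv.1.not_ge (hu ⟨⟨hw, huwv.2.le⟩, hwF⟩)
  · exact huwv.2.not_ge (hv ⟨⟨hw, (hu ⟨⟨hx.1, hxv⟩, hx.2⟩).trans huwv.1.le⟩, hwG⟩)

theorem exists_isJump (h : IsCompactOrdered A) (hA : ¬ IsPreconnected A) :
    ∃ u v, IsJump A u v := by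
  simp only [isPreconnected_closed_iff, not_forall, not_nonempty_iff_eq_empty] at hA
  obtain ⟨F, G, hF, hG, hcov, ⟨x, hx⟩, ⟨y, hy⟩, hdisj⟩ := hA
  have hne : x ≠ y := by
    rintro rfl
    exact hdisj.subset ⟨hx.1, hx.2, hy.2⟩
  rcases hne.lt_or_gt with hxy | hyx
  · exact h.exists_isJump_of_isClosed_cover hF hG hcov hdisj hx hy hxy
  · exact h.exists_isJump_of_isClosed_cover hG hF (union_comm F G ▸ hcov)
      (inter_comm F G ▸ hdisj) hy hx hyx

theorem exists_isJump_Icc (h : IsCompactOrdered A) (hx : x ∈ A) (hy : y ∈ A)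
    (hxy : ¬ IsPreconnected (A ∩ Icc x y)) : ∃ u v, IsJump A u v ∧ x ≤ u ∧ v ≤ y := by
  obtain ⟨u, v, hu, hv, huv, hgap⟩ :=
    (h.mono inter_subset_left (h.isClosed_inter_Icc hx hy)).exists_isJump hxy
  refine ⟨u, v, ⟨hu.1, hv.1, huv, fun w hw => ?_⟩, hu.2.1, hv.2.2⟩
  by_contra! huwv
  have := hgap w ⟨hw, hu.2.1.trans huwv.1.le, huwv.2.le.trans hv.2.2⟩
  exact this.elim huwv.1.not_ge huwv.2.not_ge

theorem isPreconnected_inter_Icc (h : IsCompactOrdered A) (hA : IsPreconnected A) (hx : x ∈ A)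
    (hy : y ∈ A) : IsPreconnected (A ∩ Icc x y) := by
  by_contra hxy
  obtain ⟨u, v, hj, -⟩ := h.exists_isJump_Icc hx hy hxy
  exact h.not_isPreconnected_of_isJump hj Subset.rfl hj.1 hj.2.1 hA

theorem image {Z : Type*} [TopologicalSpace Z] [T2Space Z] {g : Y → Z} (h : IsCompactOrdered A)
    (hg : ContinuousOn g A) (hinj : InjOn g A) :
    ∃ _ : LinearOrder Z, IsCompactOrdered (g '' A) ∧ StrictMonoOn g A := by
  obtain ⟨_, hmono⟩ := exists_linearOrder_strictMonoOn hinj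
  have hclosed : ∀ B ⊆ A, IsClosed B → IsClosed (g '' B) := fun B hBA hB =>
    ((h.isCompact.of_isClosed_subset hB hBA).image_of_continuousOn (hg.mono hBA)).isClosed
  refine ⟨_, ⟨h.isCompact.image_of_continuousOn hg, ?_, ?_⟩, hmono⟩
  · rintro _ ⟨x, hx, rfl⟩
    have hray : A ∩ g ⁻¹' Iic (g x) = A ∩ Iic x :=
      ext fun y => and_congr_right fun hy => hmono.le_iff_le hy hx
    rw [← image_inter_preimage, hray]
    exact hclosed _ inter_subset_left (h.isClosed_inter_Iic x hx)
  · rintro _ ⟨x, hx, rfl⟩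
    have hray : A ∩ g ⁻¹' Ici (g x) = A ∩ Ici x :=
      ext fun y => and_congr_right fun hy => hmono.le_iff_le hx hy
    rw [← image_inter_preimage, hray]
    exact hclosed _ inter_subset_left (h.isClosed_inter_Ici x hx)

end IsCompactOrdered

theorem IsOrderable.exists_isCompactOrdered {Y : Type*} [TopologicalSpace Y] [T2Space Y]
    {N U : Set Y} (hU : IsOrderable U) (hN : IsCompact N) (hNU : N ⊆ U) :
    ∃ _ : LinearOrder Y, IsCompactOrdered N := by
  obtain ⟨_, _⟩ := hU
  have hN' : IsCompactOrdered ((↑) ⁻¹' N : Set U) := .of_isCompact <|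
    IsEmbedding.subtypeVal.isCompact_iff.2
      (by rwa [Subtype.image_preimage_coe, inter_eq_right.2 hNU])
  obtain ⟨_, hval, -⟩ := hN'.image continuous_subtype_val.continuousOn Subtype.val_injective.injOn
  exact ⟨_, by rwa [Subtype.image_preimage_coe, inter_eq_right.2 hNU] at hval⟩

end CompactOrderedSets

section Arcs

theorem exists_linearOrder_concat {Y K₁ K₂ : Type*} [LinearOrder K₁] [LinearOrder K₂] {A : Set Y}
    {f₁ : Y → K₁} {f₂ : Y → K₂} (h₁ : InjOn f₁ A) (h₂ : InjOn f₂ Aᶜ) :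
    ∃ _ : LinearOrder Y, (∀ x ∈ A, ∀ y ∈ A, x ≤ y ↔ f₁ x ≤ f₁ y) ∧
      (∀ x ∉ A, ∀ y ∉ A, x ≤ y ↔ f₂ x ≤ f₂ y) ∧ ∀ x ∈ A, ∀ y ∉ A, x < y := by
  classical
  let f : Y → K₁ ⊕ₗ K₂ := fun x => if x ∈ A then Sum.inlₗ (f₁ x) else Sum.inrₗ (f₂ x)
  have hf : Function.Injective f := fun x y hxy => by
    by_cases hx : x ∈ A <;> by_cases hy : y ∈ A <;> simp only [f, hx, hy, if_true, if_false] at hxy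
    · exact h₁ hx hy (by simpa using hxy)
    · simp at hxy
    · simp at hxy
    · exact h₂ hx hy (by simpa using hxy)
  refine ⟨LinearOrder.lift' f hf, fun x hx y hy => ?_, fun x hx y hy => ?_, fun x hx y hy => ?_⟩
  · change f x ≤ f y ↔ _
    simp [f, hx, hy]
  · change f x ≤ f y ↔ _
    simp [f, hx, hy]
  · change f x < f y
    simp [f, hx, hy]

theorem exists_linearOrder_union {Y : Type*} {A B : Set Y} {b : Y} (L₁ L₂ : LinearOrder Y)
    (hA : ∀ x ∈ A, L₁.le x b) (hB : ∀ x ∈ B, L₂.le b x) (hAB : A ∩ B ⊆ {b}) :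
    ∃ _ : LinearOrder Y, (∀ x ∈ A, ∀ y ∈ A, x ≤ y ↔ L₁.le x y) ∧
      (∀ x ∈ B, ∀ y ∈ B, x ≤ y ↔ L₂.le x y) ∧ ∀ x ∈ A, ∀ y ∈ B, x ≤ y := by
  obtain ⟨L, hLA, hLB, hlt⟩ := @exists_linearOrder_concat Y Y Y L₁ L₂ A id id
    Function.injective_id.injOn Function.injective_id.injOn
  have hle : ∀ x ∈ A, ∀ y ∈ B, x ≤ y := fun x hx y hy => by
    by_cases hyA : y ∈ A
    · obtain rfl := hAB ⟨hyA, hy⟩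
      exact (hLA x hx y hyA).2 (hA x hx)
    · exact (hlt x hx y hyA).le
  refine ⟨L, hLA, fun x hx y hy => ?_, hle⟩
  by_cases hxA : x ∈ A
  · obtain rfl := hAB ⟨hxA, hx⟩
    exact iff_of_true (hle x hxA y hy) (hB y hy)
  by_cases hyA : y ∈ A
  · obtain rfl := hAB ⟨hyA, hy⟩
    exact iff_of_false (hlt y hyA x hxA).not_ge fun hxy =>
      hxA (L₂.le_antisymm x y hxy (hB x hx) ▸ hyA)
  · exact hLB x hxA y hyA

variable {Y Z : Type*} [TopologicalSpace Y] [TopologicalSpace Z]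

/-- `A` is compact and ordered with first point `a` and last point `b`, for some order on the
ambient space. -/
def IsSegment (A : Set Y) (a b : Y) : Prop :=
  ∃ _ : LinearOrder Y, IsCompactOrdered A ∧ IsLeast A a ∧ IsGreatest A b

/-- A connected segment. An arc need not be homeomorphic to a real interval, and `a = b` is
allowed. -/
structure IsArc (A : Set Y) (a b : Y) : Prop where
  isSegment : IsSegment A a b
  isPreconnected : IsPreconnected A

theorem IsCompactOrdered.isOrderable [LinearOrder Y] {A : Set Y} (h : IsCompactOrdered A) :
    IsOrderable A :=
  ⟨inferInstance, h.orderTopology⟩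

theorem IsCompactOrdered.isArc_inter_Icc [LinearOrder Y] {A : Set Y} {x y : Y}
    (h : IsCompactOrdered A) (hx : x ∈ A) (hy : y ∈ A) (hxy : x ≤ y)
    (hconn : IsPreconnected (A ∩ Icc x y)) : IsArc (A ∩ Icc x y) x y :=
  ⟨⟨_, h.mono inter_subset_left (h.isClosed_inter_Icc hx hy),
    ⟨⟨hx, le_rfl, hxy⟩, fun _ hz => hz.2.1⟩, ⟨hy, hxy, le_rfl⟩, fun _ hz => hz.2.2⟩, hconn⟩

namespace IsSegment

variable {A B : Set Y} {a b c : Y}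

theorem symm (h : IsSegment A a b) : IsSegment A b a := by
  obtain ⟨_, hA, ha, hb⟩ := h
  exact ⟨OrderDual.instLinearOrder Y, hA.dual, hb.dual, ha.dual⟩

theorem isClosed (h : IsSegment A a b) : IsClosed A := by
  obtain ⟨_, hA, -⟩ := h
  exact hA.isClosed

theorem left_mem (h : IsSegment A a b) : a ∈ A := by
  obtain ⟨_, -, ha, -⟩ := h
  exact ha.1

theorem isOrderable (h : IsSegment A a b) : IsOrderable A := by
  obtain ⟨_, hA, -⟩ := h
  exact hA.isOrderable

theorem eq_of_mem (h : IsSegment A a a) (hb : b ∈ A) : b = a := by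
  obtain ⟨_, -, hmin, hmax⟩ := h
  exact le_antisymm (hmax.2 hb) (hmin.2 hb)

theorem image [T2Space Z] {g : Y → Z} (h : IsSegment A a b) (hg : ContinuousOn g A)
    (hinj : InjOn g A) : IsSegment (g '' A) (g a) (g b) := by
  obtain ⟨_, hA, ha, hb⟩ := h
  obtain ⟨_, hgA, hmono⟩ := hA.image hg hinj
  exact ⟨_, hgA, hmono.monotoneOn.map_isLeast ha, hmono.monotoneOn.map_isGreatest hb⟩

theorem union (hA : IsSegment A a b) (hB : IsSegment B b c) (hAB : A ∩ B ⊆ {b}) :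
    IsSegment (A ∪ B) a c := by
  have hAclosed := hA.isClosed
  have hBclosed := hB.isClosed
  obtain ⟨L₁, ⟨hAcpt, hAIic, hAIci⟩, ⟨haA, ha⟩, -, hAb⟩ := hA
  obtain ⟨L₂, ⟨hBcpt, hBIic, hBIci⟩, ⟨-, hbB⟩, hcB, hc⟩ := hB
  obtain ⟨_, hleA, hleB, hle⟩ := exists_linearOrder_union L₁ L₂ @hAb @hbB hAB
  have hmem : ∀ x ∈ A, ∀ y ∈ B, y ≤ x → y ∈ A ∧ x ∈ B := fun x hx y hy hyx => by
    obtain rfl := le_antisymm hyx (hle x hx y hy)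
    exact ⟨hx, hy⟩
  refine ⟨_, ⟨hAcpt.union hBcpt, ?_, ?_⟩, ⟨Or.inl haA, ?_⟩, Or.inr hcB, ?_⟩
  · rintro x (hx | hx)
    · convert hAIic x hx using 1
      ext y
      change (y ∈ A ∨ y ∈ B) ∧ y ≤ x ↔ y ∈ A ∧ L₁.le y x
      have := fun hy => hleA y hy x hx
      have := hmem x hx y
      tauto
    · convert hAclosed.union (hBIic x hx) using 1
      ext y
      change (y ∈ A ∨ y ∈ B) ∧ y ≤ x ↔ y ∈ A ∨ y ∈ B ∧ L₂.le y x
      have := fun hy => hleB y hy x hx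
      have := fun hy => hle y hy x hx
      tauto
  · rintro x (hx | hx)
    · convert (hAIci x hx).union hBclosed using 1
      ext y
      change (y ∈ A ∨ y ∈ B) ∧ x ≤ y ↔ y ∈ A ∧ L₁.le x y ∨ y ∈ B
      have := hleA x hx y
      have := hle x hx y
      tauto
    · convert hBIci x hx using 1
      ext y
      change (y ∈ A ∨ y ∈ B) ∧ x ≤ y ↔ y ∈ B ∧ L₂.le x y
      have := hleB x hx y
      have := fun hy => hmem y hy x hx
      tauto
  · exact fun x hx => hx.elim (fun hx => (hleA a haA x hx).2 (ha hx)) (hle a haA x)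
  · exact fun x hx => hx.elim (hle x · c hcB) (fun hx => (hleB x hx c hcB).2 (hc hx))

end IsSegment

namespace IsArc

variable {A B F W : Set Y} {a b c x : Y}

theorem symm (h : IsArc A a b) : IsArc A b a := ⟨h.isSegment.symm, h.isPreconnected⟩

theorem left_mem (h : IsArc A a b) : a ∈ A := h.isSegment.left_mem

theorem right_mem (h : IsArc A a b) : b ∈ A := h.symm.left_mem

theorem isClosed (h : IsArc A a b) : IsClosed A := h.isSegment.isClosed

theorem union (hA : IsArc A a b) (hB : IsArc B b c) (hAB : A ∩ B ⊆ {b}) : IsArc (A ∪ B) a c :=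
  ⟨hA.isSegment.union hB.isSegment hAB,
    hA.isPreconnected.union b hA.right_mem hB.left_mem hB.isPreconnected⟩

theorem image [T2Space Z] {g : Y → Z} (h : IsArc A a b) (hg : ContinuousOn g A)
    (hinj : InjOn g A) : IsArc (g '' A) (g a) (g b) :=
  ⟨h.isSegment.image hg hinj, h.isPreconnected.image g hg⟩

theorem split (h : IsArc A a b) (hx : x ∈ A) :
    ∃ B C, IsArc B a x ∧ IsArc C x b ∧ B ∪ C = A ∧ B ∩ C = {x} := by
  obtain ⟨⟨_, hA, ha, hb⟩, hconn⟩ := h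
  refine ⟨A ∩ Icc a x, A ∩ Icc x b,
    hA.isArc_inter_Icc ha.1 hx (ha.2 hx) (hA.isPreconnected_inter_Icc hconn ha.1 hx),
    hA.isArc_inter_Icc hx hb.1 (hb.2 hx) (hA.isPreconnected_inter_Icc hconn hx hb.1), ?_, ?_⟩
  · rw [← inter_union_distrib_left, Icc_union_Icc_eq_Icc (ha.2 hx) (hb.2 hx)]
    exact inter_eq_left.2 fun y hy => ⟨ha.2 hy, hb.2 hy⟩
  · rw [← inter_inter_distrib_left, Icc_inter_Icc_eq_singleton (ha.2 hx) (hb.2 hx)]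
    exact inter_eq_right.2 (singleton_subset_iff.2 hx)

theorem exists_initial_subarc (h : IsArc A a b) (hab : a ≠ b) (hW : W ∈ 𝓝[A] a) :
    ∃ D c, IsArc D a c ∧ a ≠ c ∧ D ⊆ A ∩ W ∧ D ∈ 𝓝[A] a := by
  obtain ⟨⟨_, hA, ha, hb⟩, hconn⟩ := h
  have hlt : a < b := lt_of_le_of_ne (ha.2 hb.1) hab
  obtain ⟨u, huA, hau, huW⟩ := hA.dual.exists_Ioc_subset ha.1 hW hb.1 hlt
  obtain ⟨c, hcA, hac, hcu⟩ := hA.exists_between hconn ha.1 huA hau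
  refine ⟨A ∩ Icc a c, c,
    hA.isArc_inter_Icc ha.1 hcA hac.le (hA.isPreconnected_inter_Icc hconn ha.1 hcA), hac.ne,
    fun z hz => ⟨hz.1, huW ⟨hz.1, hz.2.2.trans_lt hcu, hz.2.1⟩⟩, ?_⟩
  filter_upwards [self_mem_nhdsWithin, hA.Iio_mem_nhdsWithin hcA hac] with z hzA hzc
  exact ⟨hzA, ha.2 hzA, hzc.le⟩

theorem exists_first_hit (h : IsArc A a b) (hF : IsClosed F) (hAF : (A ∩ F).Nonempty) :
    ∃ y ∈ A ∩ F, ∃ D ⊆ A, IsArc D a y ∧ D ∩ F ⊆ {y} := by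
  obtain ⟨⟨_, hA, ha, -⟩, hconn⟩ := h
  obtain ⟨y, hy, hymin⟩ := hA.exists_isLeast inter_subset_left (hA.isClosed.inter hF) hAF
  exact ⟨y, hy, A ∩ Icc a y, inter_subset_left, hA.isArc_inter_Icc ha.1 hy.1 (ha.2 hy.1)
    (hA.isPreconnected_inter_Icc hconn ha.1 hy.1),
    fun z hz => le_antisymm hz.1.2.2 (hymin ⟨hz.1.1, hz.2⟩)⟩

end IsArc

namespace IsCompactOrdered

variable [LinearOrder Y] {N F : Set Y} {d e x : Y}

theorem isLeast_of_isArc (h : IsCompactOrdered N) (hF : IsArc F d e) (hFN : F ⊆ N) (hde : d < e) :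
    IsLeast F d := by
  refine ⟨hF.left_mem, fun x hx => ?_⟩
  by_contra! hxd
  obtain ⟨B, C, hB, hC, hBC, hBCx⟩ := hF.split hx
  have hdC : d ∈ C := h.mem_of_isPreconnected hC.isPreconnected
    ((subset_union_right.trans hBC.subset).trans hFN) hC.left_mem hC.right_mem
    (hFN hF.left_mem) hxd.le hde.le
  exact hxd.ne' (hBCx.subset ⟨hB.left_mem, hdC⟩)

theorem eq_inter_Icc_of_isArc (h : IsCompactOrdered N) (hF : IsArc F d e) (hFN : F ⊆ N)
    (hde : d < e) : F = N ∩ Icc d e :=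
  Subset.antisymm
    (fun _ hx => ⟨hFN hx, (h.isLeast_of_isArc hF hFN hde).2 hx,
      (h.dual.isLeast_of_isArc hF.symm hFN hde).2 hx⟩)
    fun _ hx => h.mem_of_isPreconnected hF.isPreconnected hFN hF.left_mem hF.right_mem hx.1
      hx.2.1 hx.2.2

theorem mem_nhds_of_isArc (h : IsCompactOrdered N) (hN : N ∈ 𝓝 x) (hF : IsArc F d e)
    (hFN : F ⊆ N) (hx : x ∈ F) (hxd : x ≠ d) (hxe : x ≠ e) : F ∈ 𝓝 x := by
  wlog hde : d < e generalizing d e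
  · rcases (not_lt.1 hde).eq_or_lt with rfl | hed
    · exact (hxd (hF.isSegment.eq_of_mem hx)).elim
    · exact this hF.symm hxe hxd hed
  have hF_eq := h.eq_inter_Icc_of_isArc hF hFN hde
  have hxI := (hF_eq.subset hx).2
  rw [hF_eq, ← nhdsWithin_eq_nhds.2 hN]
  filter_upwards [self_mem_nhdsWithin,
    h.Ioi_mem_nhdsWithin (hFN hF.left_mem) (lt_of_le_of_ne hxI.1 hxd.symm),
    h.Iio_mem_nhdsWithin (hFN hF.right_mem) (lt_of_le_of_ne hxI.2 hxe)] with y hyN hdy hye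
  exact ⟨hyN, hdy.le, hye.le⟩

end IsCompactOrdered

end Arcs

section LocallyOrderedSpaces

theorem IsCompactOrdered.not_inter_Icc_subset_interior_of_isJump {Y : Type*} [TopologicalSpace Y]
    [LinearOrder Y] {N C : Set Y} {u₁ v₁ u₂ v₂ : Y} (h : IsCompactOrdered N)
    (hC : IsPreconnected C) (hCc : IsClosed C) (h₁ : IsJump (C ∩ N) u₁ v₁)
    (h₂ : IsJump (C ∩ N) u₂ v₂) (hvu : v₁ ≤ u₂) : ¬ C ∩ N ∩ Icc v₁ u₂ ⊆ interior N := by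
  intro hsub
  have hM : IsCompactOrdered (C ∩ N) := h.mono inter_subset_right (hCc.inter h.isClosed)
  obtain ⟨hu₁, hv₁, huv₁, hgap₁⟩ := h₁
  obtain ⟨hu₂, hv₂, huv₂, hgap₂⟩ := h₂
  have hcov : C ⊆ C ∩ N ∩ Icc v₁ u₂ ∪ (C ∩ N ∩ Iic u₁ ∪ C ∩ N ∩ Ici v₂ ∪ C ∩ (interior N)ᶜ) := by
    intro z hz
    by_cases hzN : z ∈ interior N
    · have hzM : z ∈ C ∩ N := ⟨hz, interior_subset hzN⟩
      rcases hgap₁ z hzM with hzu₁ | hvz₁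
      · exact Or.inr (Or.inl (Or.inl ⟨hzM, hzu₁⟩))
      rcases hgap₂ z hzM with hzu₂ | hvz₂
      · exact Or.inl ⟨hzM, hvz₁, hzu₂⟩
      · exact Or.inr (Or.inl (Or.inr ⟨hzM, hvz₂⟩))
    · exact Or.inr (Or.inr ⟨hz, hzN⟩)
  obtain ⟨w, -, ⟨hwM, hvw, hwu⟩, hw⟩ := isPreconnected_closed_iff.1 hC (C ∩ N ∩ Icc v₁ u₂)
    (C ∩ N ∩ Iic u₁ ∪ C ∩ N ∩ Ici v₂ ∪ C ∩ (interior N)ᶜ) (hM.isClosed_inter_Icc hv₁ hu₂)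
    (((hM.isClosed_inter_Iic u₁ hu₁).union (hM.isClosed_inter_Ici v₂ hv₂)).union
      (hCc.inter isOpen_interior.isClosed_compl))
    hcov ⟨v₁, hv₁.1, hv₁, le_rfl, hvu⟩ ⟨u₁, hu₁.1, Or.inl (Or.inl ⟨hu₁, le_rfl⟩)⟩
  rcases hw with (⟨-, hwu₁⟩ | ⟨-, hvw₂⟩) | ⟨-, hwN⟩
  · exact (hvw.trans hwu₁).not_gt huv₁
  · exact (hvw₂.trans hwu).not_gt huv₂
  · exact hwN (hsub ⟨hwM, hvw, hwu⟩)

-- Jumps of `C ∩ N` accumulating at `x` from the left would cut a clopen piece out of `C`.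
theorem IsCompactOrdered.exists_isPreconnected_Icc_left {Y : Type*} [TopologicalSpace Y]
    [LinearOrder Y] {N C : Set Y} {x : Y} (h : IsCompactOrdered N) (hN : N ∈ 𝓝 x)
    (hC : IsPreconnected C) (hCc : IsClosed C) (hx : x ∈ C) :
    ∃ l ∈ C ∩ N, l ≤ x ∧ IsPreconnected (C ∩ N ∩ Icc l x) ∧ Ici l ∈ 𝓝[C ∩ N] x := by
  have hM : IsCompactOrdered (C ∩ N) := h.mono inter_subset_right (hCc.inter h.isClosed)
  have hxM : x ∈ C ∩ N := ⟨hx, mem_of_mem_nhds hN⟩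
  by_cases hgood : ∃ l ∈ C ∩ N, l < x ∧ IsPreconnected (C ∩ N ∩ Icc l x)
  · obtain ⟨l, hl, hlx, hconn⟩ := hgood
    exact ⟨l, hl, hlx.le, hconn,
      Filter.mem_of_superset (hM.Ioi_mem_nhdsWithin hl hlx) Ioi_subset_Ici_self⟩
  by_cases hiso : Ici x ∈ 𝓝[C ∩ N] x
  · refine ⟨x, hxM, le_rfl, ?_, hiso⟩
    rw [Icc_self]
    exact (subsingleton_singleton.anti inter_subset_right).isPreconnected
  exfalso
  push Not at hgood
  have hleft : ∀ W ∈ 𝓝[C ∩ N] x, ∃ z ∈ C ∩ N ∩ W, z < x := fun W hW => by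
    by_contra! hno
    exact hiso (Filter.mem_of_superset (Filter.inter_mem self_mem_nhdsWithin hW) hno)
  obtain ⟨y, ⟨hyM, -⟩, hyx⟩ := hleft univ Filter.univ_mem
  obtain ⟨l, hl, hlx, hlN⟩ := hM.exists_Ioc_subset hxM
    (mem_nhdsWithin_of_mem_nhds (interior_mem_nhds.2 hN)) hyM hyx
  obtain ⟨u₁, v₁, hj₁, hlu₁, hvx₁⟩ := hM.exists_isJump_Icc hl hxM (hgood l hl hlx)
  obtain ⟨hu₁, hv₁, huv₁, hgap₁⟩ := id hj₁
  have hv₁x : v₁ < x := by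
    refine lt_of_le_of_ne hvx₁ ?_
    rintro rfl
    obtain ⟨z, ⟨hz, hu₁z⟩, hzx⟩ := hleft _ (hM.Ioi_mem_nhdsWithin hu₁ huv₁)
    exact (hgap₁ z hz).elim hu₁z.not_ge hzx.not_ge
  obtain ⟨u₂, v₂, hj₂, hvu, hvx₂⟩ := hM.exists_isJump_Icc hv₁ hxM (hgood v₁ hv₁ hv₁x)
  refine h.not_inter_Icc_subset_interior_of_isJump hC hCc hj₁ hj₂ hvu fun z hz => hlN ⟨hz.1, ?_⟩
  exact ⟨(hlu₁.trans_lt huv₁).trans_le hz.2.1, (hz.2.2.trans hj₂.2.2.1.le).trans hvx₂⟩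

theorem IsCompactOrdered.exists_isPreconnected_Icc_right {Y : Type*} [TopologicalSpace Y]
    [LinearOrder Y] {N C : Set Y} {x : Y} (h : IsCompactOrdered N) (hN : N ∈ 𝓝 x)
    (hC : IsPreconnected C) (hCc : IsClosed C) (hx : x ∈ C) :
    ∃ r ∈ C ∩ N, x ≤ r ∧ IsPreconnected (C ∩ N ∩ Icc x r) ∧ Iic r ∈ 𝓝[C ∩ N] x := by
  obtain ⟨r, hr, hxr, hconn, hnhds⟩ := h.dual.exists_isPreconnected_Icc_left hN hC hCc hx
  refine ⟨OrderDual.ofDual r, hr, hxr, ?_, hnhds⟩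
  rw [← Ici_inter_Iic, inter_comm (Ici x)]
  exact hconn

variable {Y : Type*} [TopologicalSpace Y] [T2Space Y] [LocallyCompactSpace Y]

theorem IsLocallyOrdered.exists_isCompactOrdered (hY : IsLocallyOrdered Y) {x : Y} {W : Set Y}
    (hW : W ∈ 𝓝 x) : ∃ N ∈ 𝓝 x, N ⊆ W ∧ ∃ _ : LinearOrder Y, IsCompactOrdered N := by
  obtain ⟨U, hU, hUord⟩ := hY x
  obtain ⟨N, hN, hNUW, hNcpt⟩ := local_compact_nhds (Filter.inter_mem hU hW)
  exact ⟨N, hN, hNUW.trans inter_subset_right,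
    hUord.exists_isCompactOrdered hNcpt (hNUW.trans inter_subset_left)⟩

theorem IsLocallyOrdered.exists_isArc (hY : IsLocallyOrdered Y) {C : Set Y} {x : Y}
    (hC : IsPreconnected C) (hCc : IsClosed C) (hx : x ∈ C) :
    ∃ A a b, IsArc A a b ∧ A ⊆ C ∧ A ∈ 𝓝[C] x := by
  obtain ⟨N, hN, -, _, hNord⟩ := hY.exists_isCompactOrdered (Filter.univ_mem (f := 𝓝 x))
  have hM : IsCompactOrdered (C ∩ N) := hNord.mono inter_subset_right (hCc.inter hNord.isClosed)
  have hxM : x ∈ C ∩ N := ⟨hx, mem_of_mem_nhds hN⟩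
  obtain ⟨l, hl, hlx, hlconn, hlnhds⟩ := hNord.exists_isPreconnected_Icc_left hN hC hCc hx
  obtain ⟨r, hr, hxr, hrconn, hrnhds⟩ := hNord.exists_isPreconnected_Icc_right hN hC hCc hx
  have hconn : IsPreconnected (C ∩ N ∩ Icc l r) := by
    rw [← Icc_union_Icc_eq_Icc hlx hxr, inter_union_distrib_left]
    exact hlconn.union x ⟨hxM, hlx, le_rfl⟩ ⟨hxM, le_rfl, hxr⟩ hrconn
  refine ⟨C ∩ N ∩ Icc l r, l, r, hM.isArc_inter_Icc hl hr (hlx.trans hxr) hconn,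
    inter_subset_left.trans inter_subset_left, ?_⟩
  rw [← nhdsWithin_inter_of_mem' (mem_nhdsWithin_of_mem_nhds hN)]
  filter_upwards [self_mem_nhdsWithin, hlnhds, hrnhds] with z hz hlz hzr
  exact ⟨hz, hlz, hzr⟩

theorem IsArc.mem_nhds (hY : IsLocallyOrdered Y) {A : Set Y} {a b x : Y} (h : IsArc A a b)
    (hx : x ∈ A) (hxa : x ≠ a) (hxb : x ≠ b) : A ∈ 𝓝 x := by
  obtain ⟨N, hN, -, _, hNord⟩ := hY.exists_isCompactOrdered (Filter.univ_mem (f := 𝓝 x))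
  have hNx : ∀ B : Set Y, N ∈ 𝓝[B] x := fun _ => mem_nhdsWithin_of_mem_nhds hN
  obtain ⟨B, C, hB, hC, rfl, hBC⟩ := h.split hx
  obtain ⟨D, d, hD, hxd, hDB, -⟩ := hB.symm.exists_initial_subarc hxa (hNx B)
  obtain ⟨E, e, hE, hxe, hEC, -⟩ := hC.exists_initial_subarc hxb (hNx C)
  have hDE : IsArc (D ∪ E) d e := hD.symm.union hE fun z hz =>
    hBC.subset ⟨(hDB hz.1).1, (hEC hz.2).1⟩
  exact Filter.mem_of_superset
    (hNord.mem_nhds_of_isArc hN hDE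
      (union_subset (hDB.trans inter_subset_right) (hEC.trans inter_subset_right))
      (Or.inl hD.left_mem) hxd hxe)
    (union_subset_union (hDB.trans inter_subset_left) (hEC.trans inter_subset_left))

theorem IsArc.eq_or_eq_of_inter_subset (hY : IsLocallyOrdered Y) {A D : Set Y} {a b y e : Y}
    (hA : IsArc A a b) (hD : IsArc D y e) (hye : y ≠ e) (hy : y ∈ A) (hDA : D ∩ A ⊆ {y}) :
    y = a ∨ y = b := by
  by_contra! hne
  obtain ⟨E, e', hE, hye', hED, -⟩ := hD.exists_initial_subarc hye
    (mem_nhdsWithin_of_mem_nhds (hA.mem_nhds hY hy hne.1 hne.2))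
  exact hye' (hDA ⟨(hED hE.right_mem).1, (hED hE.right_mem).2⟩).symm

end LocallyOrderedSpaces

section Loops

variable {Y : Type*} [TopologicalSpace Y]

/-- `L` is the union of two arcs which join `p` to another point and meet only in their two
common endpoints: the intrinsic form of a loop-ordered subspace with base point `p`. -/
def IsLoop (L : Set Y) (p : Y) : Prop :=
  ∃ A B q, p ≠ q ∧ IsArc A p q ∧ IsArc B p q ∧ A ∩ B ⊆ {p, q} ∧ L = A ∪ B

namespace IsLoop

variable {L : Set Y} {p t : Y}

theorem isClosed (h : IsLoop L p) : IsClosed L := by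
  obtain ⟨A, B, q, -, hA, hB, -, rfl⟩ := h
  exact hA.isClosed.union hB.isClosed

theorem base_mem (h : IsLoop L p) : p ∈ L := by
  obtain ⟨A, B, q, -, hA, -, -, rfl⟩ := h
  exact Or.inl hA.left_mem

theorem rotate (h : IsLoop L p) (ht : t ∈ L) : IsLoop L t := by
  obtain ⟨A, B, q, hpq, hA, hB, hAB, rfl⟩ := h
  wlog htA : t ∈ A generalizing A B
  · rw [union_comm]
    exact this B A hB hA (inter_comm A B ▸ hAB) (union_comm A B ▸ ht) (ht.resolve_left htA)
  by_cases htp : t = p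
  · exact htp ▸ ⟨A, B, q, hpq, hA, hB, hAB, rfl⟩
  by_cases htq : t = q
  · exact htq ▸ ⟨A, B, p, hpq.symm, hA.symm, hB.symm, pair_comm p q ▸ hAB, rfl⟩
  obtain ⟨D, E, hD, hE, rfl, hDE⟩ := hA.split htA
  have hpE : p ∉ E := fun hpE => htp (hDE.subset ⟨hD.left_mem, hpE⟩).symm
  have hqD : q ∉ D := fun hqD => htq (hDE.subset ⟨hqD, hE.right_mem⟩).symm
  refine ⟨E, D ∪ B, q, htq, hE, hD.symm.union hB ?_, ?_, by rw [← union_assoc, union_comm E]⟩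
  · rintro z ⟨hzD, hzB⟩
    exact (hAB ⟨Or.inl hzD, hzB⟩).resolve_right fun hzq => hqD (hzq ▸ hzD)
  · rintro z ⟨hzE, hzD | hzB⟩
    · exact Or.inl (hDE.subset ⟨hzD, hzE⟩)
    · exact Or.inr ((hAB ⟨Or.inr hzE, hzB⟩).resolve_left fun hzp => hpE (hzp ▸ hzE))

theorem exists_isArc_mem_nhdsWithin [T1Space Y] (h : IsLoop L p) (ht : t ∈ L) :
    ∃ D d e, IsArc D d e ∧ D ⊆ L ∧ D ∈ 𝓝[L] t ∧ t ≠ d ∧ t ≠ e := by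
  obtain ⟨A, B, q, htq, hA, hB, hAB, rfl⟩ := h.rotate ht
  have hq : {q}ᶜ ∈ 𝓝 t := isOpen_compl_singleton.mem_nhds htq
  obtain ⟨D, d, hD, htd, hDA, hDt⟩ := hA.exists_initial_subarc htq (mem_nhdsWithin_of_mem_nhds hq)
  obtain ⟨E, e, hE, hte, hEB, hEt⟩ := hB.exists_initial_subarc htq (mem_nhdsWithin_of_mem_nhds hq)
  have hDE : D ∩ E ⊆ {t} := fun z hz =>
    (hAB ⟨(hDA hz.1).1, (hEB hz.2).1⟩).resolve_right (hDA hz.1).2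
  refine ⟨D ∪ E, d, e, hD.symm.union hE hDE,
    union_subset_union (hDA.trans inter_subset_left) (hEB.trans inter_subset_left), ?_, htd, hte⟩
  rw [nhdsWithin_union]
  exact Filter.mem_sup.2
    ⟨Filter.mem_of_superset hDt subset_union_left, Filter.mem_of_superset hEt subset_union_right⟩

theorem isClopen [T2Space Y] [LocallyCompactSpace Y] (hY : IsLocallyOrdered Y) (h : IsLoop L p) :
    IsClopen L := by
  refine ⟨h.isClosed, isOpen_iff_mem_nhds.2 fun t ht => ?_⟩
  obtain ⟨D, d, e, hD, hDL, hDt, htd, hte⟩ := h.exists_isArc_mem_nhdsWithin ht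
  exact Filter.mem_of_superset (hD.mem_nhds hY (mem_of_mem_nhdsWithin ht hDt) htd hte) hDL

end IsLoop

end Loops

section Components

theorem isPreconnected_sUnion_induction {Y : Type*} [TopologicalSpace Y] {P : Set Y → Prop}
    {𝒮 : Set (Set Y)} (hfin : 𝒮.Finite) (hne : 𝒮.Nonempty) (hconn : IsPreconnected (⋃₀ 𝒮))
    (hclosed : ∀ A ∈ 𝒮, IsClosed A) (hnonempty : ∀ A ∈ 𝒮, A.Nonempty) (hP : ∀ A ∈ 𝒮, P A)
    (hunion : ∀ A B, P A → P B → (A ∩ B).Nonempty → P (A ∪ B)) : P (⋃₀ 𝒮) := by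
  have hsUnion : ∀ 𝒯 ⊆ 𝒮, IsClosed (⋃₀ 𝒯) := fun 𝒯 h𝒯 => by
    rw [sUnion_eq_biUnion]
    exact (hfin.subset h𝒯).isClosed_biUnion fun S hS => hclosed S (h𝒯 hS)
  obtain ⟨A, hA⟩ := hne
  obtain ⟨𝒯, h𝒯⟩ := (hfin.powerset.subset (sep_subset _ _)).exists_maximal
    (s := {𝒯 ∈ 𝒫 𝒮 | 𝒯.Nonempty ∧ P (⋃₀ 𝒯)})
    ⟨{A}, singleton_subset_iff.2 hA, singleton_nonempty A, by rw [sUnion_singleton]; exact hP A hA⟩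
  obtain ⟨h𝒯𝒮, ⟨B, hB⟩, hP𝒯⟩ := h𝒯.prop
  rcases (𝒮 \ 𝒯).eq_empty_or_nonempty with hrest | ⟨D, hD⟩
  · rwa [Subset.antisymm (sdiff_eq_empty.1 hrest) h𝒯𝒮]
  obtain ⟨w, -, hw𝒯, E, ⟨hE𝒮, hE𝒯⟩, hwE⟩ := isPreconnected_closed_iff.1 hconn (⋃₀ 𝒯) (⋃₀ (𝒮 \ 𝒯))
    (hsUnion 𝒯 h𝒯𝒮) (hsUnion (𝒮 \ 𝒯) sdiff_subset)
    (by rw [← sUnion_union, union_sdiff_cancel h𝒯𝒮])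
    ((hnonempty B (h𝒯𝒮 hB)).mono fun x hx => ⟨⟨B, h𝒯𝒮 hB, hx⟩, B, hB, hx⟩)
    ((hnonempty D hD.1).mono fun x hx => ⟨⟨D, hD.1, hx⟩, D, hD, hx⟩)
  have hinsert : P (⋃₀ insert E 𝒯) := by
    rw [sUnion_insert]
    exact hunion E _ (hP E hE𝒮) hP𝒯 ⟨w, hwE, hw𝒯⟩
  exact (hE𝒯 (h𝒯.le_of_ge ⟨insert_subset hE𝒮 h𝒯𝒮, insert_nonempty E 𝒯, hinsert⟩
    (subset_insert E 𝒯) (mem_insert E 𝒯))).elim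

theorem IsCompactOrdered.exists_isSegment_of_isArc {Y : Type*} [TopologicalSpace Y] [LinearOrder Y]
    {N D K : Set Y} {a c : Y} (h : IsCompactOrdered N) (hN : N ∈ 𝓝 a) (hD : IsArc D a c)
    (hac : a < c) (hDN : D ⊆ N) (hKc : IsClosed K) (hK : K ∈ 𝓝 a) :
    ∃ P e, IsSegment P e a ∧ P ⊆ N ∩ K ∧ P ∩ D ⊆ {a} ∧ P ∪ D ∈ 𝓝 a := by
  have haN : a ∈ N := hDN hD.left_mem
  have hPc : IsClosed (N ∩ Iic a ∩ K) := (h.isClosed_inter_Iic a haN).inter hKc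
  have hPN : N ∩ Iic a ∩ K ⊆ N := inter_subset_left.trans inter_subset_left
  have haP : a ∈ N ∩ Iic a ∩ K := ⟨⟨haN, le_rfl⟩, mem_of_mem_nhds hK⟩
  obtain ⟨e, he⟩ := h.exists_isLeast hPN hPc ⟨a, haP⟩
  refine ⟨N ∩ Iic a ∩ K, e, ⟨_, h.mono hPN hPc, he, haP, fun x hx => hx.1.2⟩,
    fun x hx => ⟨hx.1.1, hx.2⟩, ?_, ?_⟩
  · rintro x ⟨⟨⟨-, hxa⟩, -⟩, hxD⟩
    exact le_antisymm hxa ((h.isLeast_of_isArc hD hDN hac).2 hxD)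
  · have hc : Iio c ∈ 𝓝 a := nhdsWithin_eq_nhds.2 hN ▸ h.Iio_mem_nhdsWithin (hDN hD.right_mem) hac
    filter_upwards [hN, hK, hc] with x hxN hxK hxc
    rw [h.eq_inter_Icc_of_isArc hD hDN hac]
    exact (le_total x a).imp (⟨⟨hxN, ·⟩, hxK⟩) (⟨hxN, ·, hxc.le⟩)

variable {Y : Type*} [TopologicalSpace Y] [T2Space Y]

theorem exists_isClopen_subset_of_forall_mem_nhds [CompactSpace Y] {x : Y} {T : Set Y}
    (hT : ∀ y ∈ connectedComponent x, T ∈ 𝓝 y) : ∃ E, IsClopen E ∧ x ∈ E ∧ E ⊆ T := by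
  rw [connectedComponent_eq_iInter_isClopen] at hT
  have : Nonempty {s : Set Y // IsClopen s ∧ x ∈ s} := ⟨⟨univ, isClopen_univ, mem_univ x⟩⟩
  obtain ⟨⟨E, hE, hxE⟩, hET⟩ := exists_subset_nhds_of_compactSpace
    (fun s t : {s : Set Y // IsClopen s ∧ x ∈ s} =>
      ⟨⟨s ∩ t, s.2.1.inter t.2.1, s.2.2, t.2.2⟩, inter_subset_left, inter_subset_right⟩)
    (fun s => s.2.1.isClosed) hT
  exact ⟨E, hE, hxE, hET⟩

variable [LocallyCompactSpace Y] {A B C : Set Y} {a b e e' : Y}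

namespace IsArc

theorem exists_extension (hY : IsLocallyOrdered Y) (hA : IsArc A a b) (hB : IsArc B e e')
    (hAB : (A ∩ B).Nonempty) : ∃ D ⊆ B, e ∈ A ∪ D ∧ ∃ a' b', IsArc (A ∪ D) a' b' := by
  by_cases heA : e ∈ A
  · exact ⟨∅, empty_subset B, Or.inl heA, a, b, by rwa [union_empty]⟩
  obtain ⟨y, ⟨-, hyA⟩, D, hDB, hD, hDA⟩ := hB.exists_first_hit hA.isClosed (inter_comm A B ▸ hAB)
  refine ⟨D, hDB, Or.inr hD.left_mem, ?_⟩
  have hye : y ≠ e := fun hye => heA (hye ▸ hyA)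
  have hAD : A ∩ D ⊆ {y} := inter_comm A D ▸ hDA
  rcases hA.eq_or_eq_of_inter_subset hY hD.symm hye hyA hDA with rfl | rfl
  · exact ⟨b, e, hA.symm.union hD.symm hAD⟩
  · exact ⟨a, e, hA.union hD.symm hAD⟩

theorem exists_isLoop (hY : IsLocallyOrdered Y) (hA : IsArc A a b) (hB : IsArc B e e')
    (he : e ∈ A) (he' : e' ∈ A) (hBA : ¬ B ⊆ A) : ∃ L, IsLoop L a ∧ L ⊆ A ∪ B := by
  obtain ⟨z, hzB, hzA⟩ := not_subset.1 hBA
  obtain ⟨B₁, B₂, hB₁, hB₂, rfl, hz⟩ := hB.split hzB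
  obtain ⟨x, ⟨hxB, hxA⟩, D₁, hD₁B, hD₁, hD₁A⟩ :=
    hB₁.symm.exists_first_hit hA.isClosed ⟨e, hB₁.left_mem, he⟩
  obtain ⟨y, ⟨hyB, hyA⟩, D₂, hD₂B, hD₂, hD₂A⟩ :=
    hB₂.exists_first_hit hA.isClosed ⟨e', hB₂.right_mem, he'⟩
  have hxz : x ≠ z := fun hxz => hzA (hxz ▸ hxA)
  have hyz : y ≠ z := fun hyz => hzA (hyz ▸ hyA)
  have hxy : x ≠ y := fun hxy => hxz (hz.subset ⟨hxB, hxy ▸ hyB⟩)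
  have hD : IsArc (D₁ ∪ D₂) x y :=
    hD₁.symm.union hD₂ fun w hw => hz.subset ⟨hD₁B hw.1, hD₂B hw.2⟩
  have hAD : A ∩ (D₁ ∪ D₂) ⊆ {x, y} := by
    rintro w ⟨hwA, hwD | hwD⟩
    · exact Or.inl (hD₁A ⟨hwD, hwA⟩)
    · exact Or.inr (hD₂A ⟨hwD, hwA⟩)
  refine ⟨A ∪ (D₁ ∪ D₂), ⟨A, D₁ ∪ D₂, b, ?_⟩,
    union_subset_union_right A (union_subset_union hD₁B hD₂B)⟩
  rcases hA.eq_or_eq_of_inter_subset hY hD₁.symm hxz hxA hD₁A with rfl | rfl <;>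
    rcases hA.eq_or_eq_of_inter_subset hY hD₂.symm hyz hyA hD₂A with rfl | rfl
  · exact (hxy rfl).elim
  · exact ⟨hxy, hA, hD, hAD, rfl⟩
  · exact ⟨hxy.symm, hA, hD.symm, pair_comm x y ▸ hAD, rfl⟩
  · exact (hxy rfl).elim

theorem exists_isArc_union_or_isLoop (hY : IsLocallyOrdered Y) (hA : IsArc A a b)
    (hB : IsArc B e e') (hAB : (A ∩ B).Nonempty) :
    (∃ a' b', IsArc (A ∪ B) a' b') ∨ ∃ L p, IsLoop L p ∧ L ⊆ A ∪ B := by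
  obtain ⟨D, hDB, heD, a₁, b₁, hAD⟩ := hA.exists_extension hY hB hAB
  obtain ⟨D', hDB', heD', a₂, b₂, hADD'⟩ := hAD.exists_extension hY hB.symm
    (hAB.mono (inter_subset_inter_left B subset_union_left))
  have hsub : A ∪ D ∪ D' ⊆ A ∪ B :=
    union_subset (union_subset_union_right A hDB) (hDB'.trans subset_union_right)
  by_cases hB_sub : B ⊆ A ∪ D ∪ D'
  · have hunion : A ∪ D ∪ D' = A ∪ B :=
      hsub.antisymm (union_subset (subset_union_left.trans subset_union_left) hB_sub)
    exact Or.inl ⟨a₂, b₂, hunion ▸ hADD'⟩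
  · obtain ⟨L, hL, hLsub⟩ := hADD'.exists_isLoop hY hB (Or.inl heD) heD' hB_sub
    exact Or.inr ⟨L, a₂, hL, hLsub.trans (union_subset hsub subset_union_right)⟩

theorem exists_isSegment_germ (hY : IsLocallyOrdered Y) (hC : IsArc C a b) (hab : a ≠ b)
    {W : Set Y} (hW : W ∈ 𝓝 a) :
    ∃ P e, IsSegment P e a ∧ P ⊆ W ∧ P ∩ C ⊆ {a} ∧ P ∪ C ∈ 𝓝 a := by
  obtain ⟨N, hN, hNW, _, hNord⟩ := hY.exists_isCompactOrdered hW
  obtain ⟨D, c, hD, hac, hDCN, hDa⟩ := hC.exists_initial_subarc hab (mem_nhdsWithin_of_mem_nhds hN)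
  have hDC : D ⊆ C := hDCN.trans inter_subset_left
  have hDN : D ⊆ N := hDCN.trans inter_subset_right
  obtain ⟨V, hV, hVD⟩ := mem_nhdsWithin_iff_exists_mem_nhds_inter.1 hDa
  obtain ⟨K, hK, hKc, hKV⟩ := exists_mem_nhds_isClosed_subset hV
  obtain ⟨P, e, hP, hPNK, hPD, hPa⟩ :
      ∃ P e, IsSegment P e a ∧ P ⊆ N ∩ K ∧ P ∩ D ⊆ {a} ∧ P ∪ D ∈ 𝓝 a := by
    rcases hac.lt_or_gt with hac | hca
    · exact hNord.exists_isSegment_of_isArc hN hD hac hDN hKc hK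
    · exact hNord.dual.exists_isSegment_of_isArc hN hD hca hDN hKc hK
  exact ⟨P, e, hP, (hPNK.trans inter_subset_left).trans hNW,
    fun x hx => hPD ⟨hx.1, hVD ⟨hKV (hPNK hx.1).2, hx.2⟩⟩,
    Filter.mem_of_superset hPa (union_subset_union_right P hDC)⟩

theorem exists_isCompactOrdered_mem_nhds (hY : IsLocallyOrdered Y) (hC : IsArc C a b) :
    ∃ T : Set Y, (∃ _ : LinearOrder Y, IsCompactOrdered T) ∧ ∀ x ∈ C, T ∈ 𝓝 x := by
  by_cases hab : a = b
  · subst hab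
    obtain ⟨N, hN, -, hNord⟩ := hY.exists_isCompactOrdered (Filter.univ_mem (f := 𝓝 a))
    exact ⟨N, hNord, fun x hx => hC.isSegment.eq_of_mem hx ▸ hN⟩
  obtain ⟨P, e, hP, hPb, hPC, hPa⟩ :=
    hC.exists_isSegment_germ hY hab (isOpen_compl_singleton.mem_nhds hab)
  obtain ⟨Q, f, hQ, hQP, hQC, hQb⟩ := hC.symm.exists_isSegment_germ hY (Ne.symm hab)
    (hP.isClosed.isOpen_compl.mem_nhds fun hbP => hPb hbP rfl)
  have hPCQ : (P ∪ C) ∩ Q ⊆ {b} := by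
    rintro x ⟨hxP | hxC, hxQ⟩
    · exact (hQP hxQ hxP).elim
    · exact hQC ⟨hxQ, hxC⟩
  obtain ⟨_, hT, -⟩ := (hP.union hC.isSegment hPC).union hQ.symm hPCQ
  refine ⟨P ∪ C ∪ Q, ⟨_, hT⟩, fun x hx => ?_⟩
  by_cases hxa : x = a
  · exact Filter.mem_of_superset (hxa ▸ hPa) subset_union_left
  by_cases hxb : x = b
  · exact Filter.mem_of_superset (hxb ▸ hQb)
      (union_subset subset_union_right (subset_union_right.trans subset_union_left))
  · exact Filter.mem_of_superset (hC.mem_nhds hY hx hxa hxb)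
      (subset_union_right.trans subset_union_left)

end IsArc

namespace IsLocallyOrdered

theorem isArc_or_isLoop (hY : IsLocallyOrdered Y) (hC : IsPreconnected C) (hCcpt : IsCompact C)
    (hCne : C.Nonempty) : (∃ a b, IsArc C a b) ∨ ∃ p, IsLoop C p := by
  by_cases hloop : ∃ L p, IsLoop L p ∧ L ⊆ C
  · obtain ⟨L, p, hL, hLC⟩ := hloop
    have hCL : C ⊆ L := hC.subset_isClopen (hL.isClopen hY) ⟨p, hLC hL.base_mem, hL.base_mem⟩
    exact Or.inr ⟨p, hLC.antisymm hCL ▸ hL⟩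
  left
  choose! N a b hN hNC hNnhds using fun x (hx : x ∈ C) => hY.exists_isArc hC hCcpt.isClosed hx
  obtain ⟨t, htC, ht⟩ := hCcpt.elim_nhdsWithin_subcover N hNnhds
  have hC_eq : C = ⋃₀ (N '' t) := by
    rw [sUnion_image]
    exact ht.antisymm (iUnion₂_subset fun x hx => hNC x (htC x hx))
  have ht_ne : (t : Set Y).Nonempty := by
    obtain ⟨x, hx⟩ := hCne
    obtain ⟨y, hy, -⟩ := mem_iUnion₂.1 (ht hx)
    exact ⟨y, hy⟩
  suffices hP : (∃ a b, IsArc (⋃₀ (N '' t)) a b) ∧ ⋃₀ (N '' t) ⊆ C from hC_eq ▸ hP.1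
  refine isPreconnected_sUnion_induction (P := fun D => (∃ a b, IsArc D a b) ∧ D ⊆ C)
    (t.finite_toSet.image N) (ht_ne.image N) (hC_eq ▸ hC)
    (forall_mem_image.2 fun x hx => (hN x (htC x hx)).isClosed)
    (forall_mem_image.2 fun x hx => ⟨a x, (hN x (htC x hx)).left_mem⟩)
    (forall_mem_image.2 fun x hx => ⟨⟨a x, b x, hN x (htC x hx)⟩, hNC x (htC x hx)⟩) ?_
  rintro A B ⟨⟨a, b, hA⟩, hAC⟩ ⟨⟨e, e', hB⟩, hBC⟩ hAB
  have hABC : A ∪ B ⊆ C := union_subset hAC hBC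
  refine ⟨(hA.exists_isArc_union_or_isLoop hY hB hAB).resolve_right ?_, hABC⟩
  rintro ⟨L, p, hL, hLAB⟩
  exact hloop ⟨L, p, hL, hLAB.trans hABC⟩

theorem exists_isClopen [CompactSpace Y] (hY : IsLocallyOrdered Y) (x : Y) :
    ∃ E : Set Y, IsClopen E ∧ x ∈ E ∧ (IsOrderable E ∨ ∃ p, IsLoop E p) := by
  rcases hY.isArc_or_isLoop isPreconnected_connectedComponent
    isClosed_connectedComponent.isCompact ⟨x, mem_connectedComponent⟩ with ⟨a, b, hC⟩ | ⟨p, hC⟩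
  · obtain ⟨T, ⟨_, hTord⟩, hT⟩ := hC.exists_isCompactOrdered_mem_nhds hY
    obtain ⟨E, hE, hxE, hET⟩ := exists_isClopen_subset_of_forall_mem_nhds hT
    exact ⟨E, hE, hxE, Or.inl (hTord.mono hET hE.isClosed).isOrderable⟩
  · exact ⟨_, hC.isClopen hY, mem_connectedComponent, Or.inr ⟨p, hC⟩⟩

end IsLocallyOrdered

end Components

section EndpointQuotient

theorem t2Space_of_isClosedMap {X Y : Type*} [TopologicalSpace X] [TopologicalSpace Y] [T4Space X]
    {f : X → Y} (hcont : Continuous f) (hclosed : IsClosedMap f) (hsurj : Function.Surjective f) :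
    T2Space Y := by
  have hfiber : ∀ y, IsClosed (f ⁻¹' {y}) := hsurj.forall.2 fun x => by
    rw [← image_singleton]
    exact (hclosed _ isClosed_singleton).preimage hcont
  refine ⟨fun a b hab => ?_⟩
  obtain ⟨U, V, hU, hV, haU, hbV, hUV⟩ := normal_separation (hfiber a) (hfiber b)
    (Disjoint.preimage f (disjoint_singleton.2 hab))
  refine ⟨kernImage f U, kernImage f V, isClosedMap_iff_kernImage.1 hclosed hU,
    isClosedMap_iff_kernImage.1 hclosed hV, fun x hx => haU hx, fun x hx => hbV hx, ?_⟩
  rw [disjoint_left, hsurj.forall]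
  exact fun x hxU hxV => disjoint_left.1 hUV (hxU rfl) (hxV rfl)

theorem nonempty_boundedOrder {K : Type*} [LinearOrder K] [TopologicalSpace K]
    [OrderClosedTopology K] [CompactSpace K] [Nonempty K] : Nonempty (BoundedOrder K) := by
  obtain ⟨b, -, hb⟩ := (isCompact_univ (X := K)).exists_isLeast univ_nonempty
  obtain ⟨t, -, ht⟩ := (isCompact_univ (X := K)).exists_isGreatest univ_nonempty
  exact ⟨{ bot := b, bot_le := (hb <| mem_univ ·), top := t, le_top := (ht <| mem_univ ·) }⟩

namespace EndpointQuotient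

variable {K : Type u} [LinearOrder K] [BoundedOrder K]

local notation "π" => (Quot.mk _ : K → EndpointQuotient K)

theorem mk_bot_eq_mk_top : π ⊥ = π ⊤ := Quot.sound ⟨isBot_bot, isTop_top⟩

theorem mk_eq_mk_iff {x y : K} :
    π x = π y ↔ x = y ∨ (x = ⊥ ∧ y = ⊤) ∨ (x = ⊤ ∧ y = ⊥) := by
  classical
  constructor
  · let r : EndpointQuotient K → K := Quot.lift (fun x => if x = ⊤ then ⊥ else x) <| by
      rintro x y ⟨hx, hy⟩
      obtain rfl := isBot_iff_eq_bot.1 hx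
      obtain rfl := isTop_iff_eq_top.1 hy
      simp
    intro hxy
    have hr : (if x = ⊤ then ⊥ else x) = if y = ⊤ then ⊥ else y := congrArg r hxy
    split_ifs at hr <;> grind
  · rintro (rfl | ⟨rfl, rfl⟩ | ⟨rfl, rfl⟩)
    exacts [rfl, mk_bot_eq_mk_top, mk_bot_eq_mk_top.symm]

theorem injOn_mk_Iic {m : K} (hm : m < ⊤) : InjOn π (Iic m) := fun x hx y hy hxy => by
  rcases mk_eq_mk_iff.1 hxy with h | ⟨-, rfl⟩ | ⟨rfl, -⟩
  exacts [h, (hm.not_ge hy).elim, (hm.not_ge hx).elim]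

theorem injOn_mk_Ici {m : K} (hm : ⊥ < m) : InjOn π (Ici m) := fun x hx y hy hxy => by
  rcases mk_eq_mk_iff.1 hxy with h | ⟨rfl, -⟩ | ⟨-, rfl⟩
  exacts [h, (hm.not_ge hx).elim, (hm.not_ge hy).elim]

variable [TopologicalSpace K]

theorem isClosedMap_mk [T1Space K] : IsClosedMap π := fun F hF => by
  rw [← isQuotientMap_quot_mk.isClosed_preimage]
  have hsat : π ⁻¹' (π '' F) = F ∪ π ⁻¹' (π '' F) ∩ {⊥, ⊤} := by
    refine Subset.antisymm ?_ (union_subset (subset_preimage_image π F) inter_subset_left)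
    rintro x ⟨y, hy, hyx⟩
    rcases mk_eq_mk_iff.1 hyx with rfl | ⟨-, hx⟩ | ⟨-, hx⟩
    exacts [Or.inl hy, Or.inr ⟨⟨y, hy, hyx⟩, Or.inr hx⟩, Or.inr ⟨⟨y, hy, hyx⟩, Or.inl hx⟩]
  rw [hsat]
  exact hF.union ((toFinite {⊥, ⊤}).subset inter_subset_right).isClosed

instance [T4Space K] : T2Space (EndpointQuotient K) :=
  t2Space_of_isClosedMap continuous_quot_mk isClosedMap_mk Quot.mk_surjective

theorem isLoop_univ [OrderTopology K] [CompactSpace K] [PreconnectedSpace K] [Nontrivial K] :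
    IsLoop (univ : Set (EndpointQuotient K)) (π ⊥) := by
  have hK : IsCompactOrdered (univ : Set K) := .of_isCompact isCompact_univ
  have hconn : IsPreconnected (univ : Set K) := isPreconnected_univ
  have harc : ∀ x y : K, x ≤ y → IsArc (Icc x y) x y := fun x y hxy => by
    simpa only [univ_inter] using hK.isArc_inter_Icc (mem_univ x) (mem_univ y) hxy
      (hK.isPreconnected_inter_Icc hconn (mem_univ x) (mem_univ y))
  obtain ⟨m, -, hbm, hmt⟩ := hK.exists_between hconn (mem_univ ⊥) (mem_univ ⊤) bot_lt_top
  have hA := (harc ⊥ m bot_le).image (g := π) continuous_quot_mk.continuousOn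
    ((injOn_mk_Iic hmt).mono Icc_subset_Iic_self)
  have hB := (harc m ⊤ le_top).image (g := π) continuous_quot_mk.continuousOn
    ((injOn_mk_Ici hbm).mono Icc_subset_Ici_self)
  rw [← mk_bot_eq_mk_top] at hB
  refine ⟨_, _, π m, ?_, hA, hB.symm, ?_, ?_⟩
  · rw [Ne, mk_eq_mk_iff]
    exact fun h => h.elim hbm.ne fun h => h.elim (hmt.ne ·.2) (bot_ne_top ·.1)
  · rintro _ ⟨⟨x, hx, rfl⟩, y, hy, hyx⟩
    rcases mk_eq_mk_iff.1 hyx with rfl | ⟨rfl, -⟩ | ⟨-, rfl⟩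
    · exact Or.inr (congrArg π (le_antisymm hx.2 hy.1))
    · exact (hbm.not_ge hy.1).elim
    · exact Or.inl rfl
  · rw [← image_union, Icc_union_Icc_eq_Icc bot_le le_top, Icc_bot_top, image_univ,
      Quot.mk_surjective.range_eq]

theorem isLocallyOrdered [OrderTopology K] [CompactSpace K] [PreconnectedSpace K] [Nontrivial K] :
    IsLocallyOrdered (EndpointQuotient K) := fun t => by
  obtain ⟨D, d, e, hD, -, hDt, -⟩ := isLoop_univ.exists_isArc_mem_nhdsWithin (mem_univ t)
  exact ⟨D, nhdsWithin_univ t ▸ hDt, hD.isSegment.isOrderable⟩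

end EndpointQuotient

end EndpointQuotient

section LoopParametrization

variable {Y Z : Type u} [TopologicalSpace Y] [TopologicalSpace Z]

theorem EndpointQuotient.exists_homeomorph_range [T2Space Y] {K : Type u} [LinearOrder K]
    [BoundedOrder K] [TopologicalSpace K] [CompactSpace K] {g : K → Y} (hg : Continuous g)
    (hends : g ⊥ = g ⊤) (hinj : ∀ x y, g x = g y → x = y ∨ (x = ⊥ ∧ y = ⊤) ∨ (x = ⊤ ∧ y = ⊥)) :
    ∃ e : EndpointQuotient K ≃ₜ range g, ∀ x, (e (Quot.mk _ x) : Y) = g x := by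
  let φ : EndpointQuotient K → range g := Quot.lift (rangeFactorization g) <| by
    rintro x y ⟨hx, hy⟩
    rw [isBot_iff_eq_bot.1 hx, isTop_iff_eq_top.1 hy]
    exact Subtype.ext hends
  have hφ : Continuous φ := continuous_quot_lift _ (hg.subtype_mk _)
  have hφ_inj : Function.Injective φ := by
    rintro ⟨x⟩ ⟨y⟩ hxy
    exact mk_eq_mk_iff.2 (hinj x y (congrArg Subtype.val hxy))
  have hφ_surj : Function.Surjective φ := by
    rintro ⟨_, x, rfl⟩
    exact ⟨Quot.mk _ x, rfl⟩
  exact ⟨hφ.homeoOfEquivCompactToT2 (f := Equiv.ofBijective φ ⟨hφ_inj, hφ_surj⟩), fun _ => rfl⟩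

theorem IsArc.exists_homeomorph_endpointQuotient [T2Space Y] {A : Set Z} {a b : Z}
    (hA : IsArc A a b) (hab : a ≠ b) {g : Z → Y} (hg : ContinuousOn g A) (hends : g a = g b)
    (hinj : ∀ x ∈ A, ∀ y ∈ A, g x = g y → x = y ∨ (x = a ∧ y = b) ∨ (x = b ∧ y = a)) :
    ∃ (K : Type u) (_ : LinearOrder K) (_ : BoundedOrder K) (_ : TopologicalSpace K),
      OrderTopology K ∧ CompactSpace K ∧ ConnectedSpace K ∧ Nontrivial K ∧
        ∃ e : EndpointQuotient K ≃ₜ g '' A, (e (Quot.mk _ ⊥) : Y) = g a := by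
  obtain ⟨⟨_, hAord, ⟨haA, ha⟩, hbA, hb⟩, hconn⟩ := hA
  have hK : CompactSpace A := isCompact_iff_compactSpace.1 hAord.isCompact
  let _ : BoundedOrder A :=
    { bot := ⟨a, haA⟩, bot_le := fun x => ha x.2, top := ⟨b, hbA⟩, le_top := fun x => hb x.2 }
  obtain ⟨e, he⟩ := EndpointQuotient.exists_homeomorph_range (g := A.domRestrict g)
    hg.domRestrict hends fun x y hxy => (hinj x x.2 y y.2 hxy).imp Subtype.ext
      (Or.imp (And.imp Subtype.ext Subtype.ext) (And.imp Subtype.ext Subtype.ext))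
  exact ⟨A, inferInstance, inferInstance, inferInstance, hAord.orderTopology, hK,
    isConnected_iff_connectedSpace.1 ⟨⟨a, haA⟩, hconn⟩,
    ⟨⊥, ⊤, fun h => hab (congrArg Subtype.val h)⟩,
    e.trans (Homeomorph.setCongr (range_domRestrict g A)), he ⊥⟩

namespace IsLoop

variable [T2Space Y] {L : Set Y} {p : Y}

-- Lifting one half of the loop to the diagonal of `Y × Y` and the other half to the line
-- `Y × {q}` separates the two copies of the base point `p`, but not those of `q`.
theorem exists_isArc_prod (h : IsLoop L p) :
    ∃ (A : Set (Y × Y)) (q : Y), p ≠ q ∧ IsArc A (p, p) (p, q) ∧ Prod.fst '' A = L ∧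
      ∀ x ∈ A, ∀ y ∈ A, x.1 = y.1 →
        x = y ∨ (x = (p, p) ∧ y = (p, q)) ∨ (x = (p, q) ∧ y = (p, p)) := by
  obtain ⟨A, B, q, hpq, hA, hB, hAB, rfl⟩ := h
  have hA' := hA.image (g := fun x => (x, x)) (by fun_prop)
    (fun x _ y _ hxy => congrArg Prod.fst hxy)
  have hB' := hB.image (g := fun x => (x, q)) (by fun_prop)
    (fun x _ y _ hxy => congrArg Prod.fst hxy)
  refine ⟨_, q, hpq, hA'.union hB'.symm ?_, ?_, ?_⟩
  · rintro _ ⟨⟨x, -, rfl⟩, y, -, hyx⟩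
    obtain ⟨rfl, rfl⟩ := Prod.mk.inj hyx
    rfl
  · simp only [image_union, image_image, image_id']
  · rintro _ (⟨x, hx, rfl⟩ | ⟨x, hx, rfl⟩) _ (⟨y, hy, rfl⟩ | ⟨y, hy, rfl⟩) hxy <;>
      obtain rfl : x = y := hxy
    · exact Or.inl rfl
    · rcases hAB ⟨hx, hy⟩ with rfl | rfl
      exacts [Or.inr (Or.inl ⟨rfl, rfl⟩), Or.inl rfl]
    · rcases hAB ⟨hy, hx⟩ with rfl | rfl
      exacts [Or.inr (Or.inr ⟨rfl, rfl⟩), Or.inl rfl]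
    · exact Or.inl rfl

theorem exists_homeomorph_endpointQuotient (h : IsLoop L p) :
    ∃ (K : Type u) (_ : LinearOrder K) (_ : BoundedOrder K) (_ : TopologicalSpace K),
      OrderTopology K ∧ CompactSpace K ∧ ConnectedSpace K ∧ Nontrivial K ∧
        ∃ e : EndpointQuotient K ≃ₜ L, (e (Quot.mk _ ⊥) : Y) = p := by
  obtain ⟨A, q, hpq, hA, rfl, hinj⟩ := h.exists_isArc_prod
  exact hA.exists_homeomorph_endpointQuotient (by simpa using hpq) continuous_fst.continuousOn rfl
    hinj

end IsLoop

end LoopParametrization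

section SuborderableSpaces

variable {X Y : Type u} [TopologicalSpace X] [TopologicalSpace Y]

theorem IsOrderable.of_homeomorph {X Y : Type*} [TopologicalSpace X] [TopologicalSpace Y]
    (h : IsOrderable Y) (e : X ≃ₜ Y) : IsOrderable X := by
  obtain ⟨_, hY⟩ := h
  let _ : LinearOrder X := LinearOrder.lift' e e.injective
  have he : StrictMono e := fun _ _ hxy => hxy
  refine ⟨inferInstance, ⟨?_⟩⟩
  rw [e.isInducing.eq_induced]
  exact he.induced_topology_eq_preorder (by rw [e.surjective.range_eq]; exact ordConnected_univ)

theorem IsOrderable.isSuborderable (h : IsOrderable X) : IsSuborderable X :=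
  ⟨X, inferInstance, h, id, IsEmbedding.id⟩

theorem IsSuborderable.of_isEmbedding {f : X → Y} (h : IsSuborderable Y) (hf : IsEmbedding f) :
    IsSuborderable X := by
  obtain ⟨Z, _, hZ, g, hg⟩ := h
  exact ⟨Z, inferInstance, hZ, g ∘ f, hg.comp hf⟩

theorem isEmbedding_principal {L : Type*} [LinearOrder L] [TopologicalSpace L] [OrderTopology L]
    [TopologicalSpace (DedekindCut L)] [OrderTopology (DedekindCut L)] :
    IsEmbedding (DedekindCut.principal : L → DedekindCut L) := by
  refine ⟨⟨?_⟩, fun x y h => DedekindCut.principal_inj.1 h⟩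
  rw [OrderTopology.topology_eq_generate_intervals (α := L)]
  refine (induced_topology_eq_preorder DedekindCut.principal_lt_principal ?_ ?_).symm
  · intro a b x hb _
    obtain ⟨y, hy, hya⟩ := DedekindCut.lt_principal_iff.1 hb
    exact ⟨y, hya, DedekindCut.le_principal_iff.2 hy⟩
  · intro a b x hb _
    obtain ⟨y, hy, hya⟩ := DedekindCut.principal_lt_iff.1 hb
    exact ⟨y, hya, DedekindCut.principal_le_iff.2 hy⟩

theorem IsSuborderable.exists_isEmbedding (h : IsSuborderable X) :
    ∃ (K : Type u) (_ : LinearOrder K) (_ : TopologicalSpace K),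
      OrderTopology K ∧ CompactSpace K ∧ ∃ f : X → K, IsEmbedding f := by
  obtain ⟨Y, _, ⟨_, _⟩, f, hf⟩ := h
  let _ : TopologicalSpace (DedekindCut Y) := Preorder.topology _
  have : OrderTopology (DedekindCut Y) := ⟨rfl⟩
  exact ⟨DedekindCut Y, inferInstance, inferInstance, inferInstance, inferInstance, _,
    isEmbedding_principal.comp hf⟩

theorem IsSuborderable.exists_isDenseEmbedding (h : IsSuborderable X) :
    ∃ (K : Type u) (_ : TopologicalSpace K),
      CompactSpace K ∧ T2Space K ∧ IsOrderable K ∧ ∃ f : X → K, IsDenseEmbedding f := by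
  obtain ⟨K, _, _, _, _, f, hf⟩ := h.exists_isEmbedding
  have hK : IsCompact (closure (range f)) := isClosed_closure.isCompact
  refine ⟨closure (range f), inferInstance, isCompact_iff_compactSpace.1 hK, inferInstance,
    (IsCompactOrdered.of_isCompact hK).isOrderable, inclusion subset_closure ∘ rangeFactorization f,
    ⟨⟨?_, ?_⟩, ?_⟩⟩
  · exact ((IsEmbedding.inclusion subset_closure).comp hf.toHomeomorph.isEmbedding).isInducing
  · exact (denseRange_inclusion_iff subset_closure).2 subset_rfl |>.comp
      rangeFactorization_surjective.denseRange (continuous_inclusion subset_closure)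
  · exact (inclusion_injective subset_closure).comp (rangeFactorization_injective.2 hf.injective)

theorem isOrderable_sigma {ι : Type*} [Finite ι] {K : ι → Type*} [∀ i, LinearOrder (K i)]
    [∀ i, TopologicalSpace (K i)] [∀ i, OrderTopology (K i)] [∀ i, CompactSpace (K i)] :
    IsOrderable (Σ i, K i) := by
  obtain ⟨n, ⟨e⟩⟩ := Finite.exists_equiv_fin ι
  let _ : LinearOrder ι := LinearOrder.lift' e e.injective
  let _ : TopologicalSpace (Σₗ i, K i) := inferInstanceAs (TopologicalSpace (Σ i, K i))
  have : CompactSpace (Σₗ i, K i) := inferInstanceAs (CompactSpace (Σ i, K i))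
  have hIic : ClosedIicTopology (Σₗ i, K i) := ⟨fun ⟨i, x⟩ => isClosed_sigma_iff.2 fun j => by
    change IsClosed {y | Sigma.Lex (· < ·) (fun _ => (· ≤ ·)) (⟨j, y⟩ : Σ i, K i) ⟨i, x⟩}
    rcases lt_trichotomy j i with hji | rfl | hij
    · simp [Sigma.lex_iff, hji]
    · simpa [Sigma.lex_iff] using! isClosed_Iic (a := x)
    · simp [Sigma.lex_iff, hij.not_gt, hij.ne']⟩
  have hIci : ClosedIciTopology (Σₗ i, K i) := ⟨fun ⟨i, x⟩ => isClosed_sigma_iff.2 fun j => by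
    change IsClosed {y | Sigma.Lex (· < ·) (fun _ => (· ≤ ·)) (⟨i, x⟩ : Σ i, K i) ⟨j, y⟩}
    rcases lt_trichotomy i j with hij | rfl | hji
    · simp [Sigma.lex_iff, hij]
    · simpa [Sigma.lex_iff] using! isClosed_Ici (a := x)
    · simp [Sigma.lex_iff, hji.not_gt, hji.ne']⟩
  have hord : IsOrderable (Σₗ i, K i) := ⟨inferInstance, orderTopology_of_compactSpace⟩
  exact hord

theorem IsSuborderable.sigma {ι : Type u} [Finite ι] {F : ι → Type u}
    [∀ i, TopologicalSpace (F i)] (hF : ∀ i, IsSuborderable (F i)) :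
    IsSuborderable (Σ i, F i) := by
  choose K _ _ _ _ f hf using fun i => (hF i).exists_isEmbedding
  exact isOrderable_sigma.isSuborderable.of_isEmbedding
    ((isEmbedding_sigmaMap Function.injective_id).2 hf)

theorem EndpointQuotient.isSuborderable {K : Type u} [LinearOrder K] [BoundedOrder K]
    [TopologicalSpace K] [OrderTopology K] {f : X → EndpointQuotient K} (hf : IsEmbedding f)
    (hbot : Quot.mk _ ⊥ ∉ range f) : IsSuborderable X := by
  let g := (range f).restrictPreimage (Quot.mk _ : K → EndpointQuotient K)
  have hg_inj : Function.Injective g := by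
    rintro ⟨x, hx⟩ ⟨y, hy⟩ hxy
    refine Subtype.ext ?_
    rcases mk_eq_mk_iff.1 (congrArg Subtype.val hxy) with h | ⟨rfl, -⟩ | ⟨-, rfl⟩
    exacts [h, (hbot hx).elim, (hbot hy).elim]
  have hg : IsHomeomorph g := isHomeomorph_iff_continuous_isClosedMap_bijective.2
    ⟨continuous_quot_mk.restrictPreimage, isClosedMap_mk.restrictPreimage _, hg_inj,
      (range f).restrictPreimage_surjective Quot.mk_surjective⟩
  exact IsSuborderable.of_isEmbedding (IsOrderable.isSuborderable ⟨‹_›, ‹_›⟩)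
    (IsEmbedding.subtypeVal.comp
      (hf.toHomeomorph.trans hg.homeomorph.symm).isEmbedding)

theorem IsLoop.isSuborderable_or_isLoopOrdered [T2Space Y] {L : Set Y} {p : Y} (h : IsLoop L p)
    {f : X → L} (hf : IsEmbedding f) : IsSuborderable X ∨ IsLoopOrdered X := by
  by_cases hsurj : Function.Surjective f
  · obtain ⟨K, _, _, _, hord, hcomp, hconn, hnont, e, -⟩ := h.exists_homeomorph_endpointQuotient
    exact Or.inr ⟨K, inferInstance, inferInstance, hord, hcomp, hconn, hnont,
      ⟨(hf.toHomeomorphOfSurjective hsurj).trans e.symm⟩⟩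
  · obtain ⟨q, hq⟩ := not_forall.1 hsurj
    obtain ⟨K, _, _, _, _, _, _, _, e, he⟩ :=
      (h.rotate q.2).exists_homeomorph_endpointQuotient
    refine Or.inl (EndpointQuotient.isSuborderable (e.symm.isEmbedding.comp hf) ?_)
    rintro ⟨x, hx⟩
    exact hq ⟨x, by rw [← e.apply_symm_apply (f x)]; exact (congrArg e hx).trans (Subtype.ext he)⟩

end SuborderableSpaces

section Decomposition

theorem exists_isLocallyConstant_mem {Y : Type*} [TopologicalSpace Y] [CompactSpace Y]
    {E : Y → Set Y} (hE : ∀ y, IsClopen (E y)) (hmem : ∀ y, y ∈ E y) :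
    ∃ (t : Finset Y) (c : Y → t), IsLocallyConstant c ∧ ∀ y, y ∈ E (c y) := by
  obtain ⟨t, ht⟩ := isCompact_univ.elim_nhds_subcover E
    fun y _ => (hE y).isOpen.mem_nhds (hmem y)
  let pattern : Y → Set t := fun y => {x | y ∈ E x}
  have hpattern : IsLocallyConstant pattern :=
    (IsLocallyConstant.iff_eventually_eq _).2 fun y => by
      have hx (x : t) : ∀ᶠ z in 𝓝 y, z ∈ E x ↔ y ∈ E x := by
        by_cases hy : y ∈ E x
        · filter_upwards [(hE x).isOpen.mem_nhds hy] with z hz using iff_of_true hz hy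
        · filter_upwards [(hE x).compl.isOpen.mem_nhds hy] with z hz using iff_of_false hz hy
      filter_upwards [Filter.eventually_all.2 hx] with z hz using Set.ext hz
  have hne (y : Y) : (pattern y).Nonempty := by
    obtain ⟨x, hxt, hx⟩ := mem_iUnion₂.1 (ht.2 (mem_univ y))
    exact ⟨⟨x, hxt⟩, hx⟩
  refine ⟨t, fun y => (hne y).some, (IsLocallyConstant.iff_eventually_eq _).2 fun y => ?_,
    fun y => (hne y).some_mem⟩
  filter_upwards [hpattern.eventually_eq y] with z hz
  simp only [hz]

theorem nonempty_homeomorph_sigma_fiber {X ι : Type*} [TopologicalSpace X] {c : X → ι}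
    (hc : IsLocallyConstant c) : Nonempty (X ≃ₜ Σ i, c ⁻¹' {i}) :=
  ⟨((Equiv.sigmaFiberEquiv c).toHomeomorphOfContinuousOpen
    (continuous_sigma fun _ => continuous_subtype_val)
    (isOpenMap_sigma.2 fun i => (hc.isOpen_fiber i).isOpenMap_subtype_val)).symm⟩

theorem nonempty_homeomorph_sum_sigma {α β ι : Type*} (e : α ⊕ β ≃ ι) (F : ι → Type*)
    [∀ i, TopologicalSpace (F i)] :
    Nonempty ((Σ i, F i) ≃ₜ (Σ a, F (e (.inl a))) ⊕ Σ b, F (e (.inr b))) := by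
  let φ : (Σ a, F (e (.inl a))) ⊕ (Σ b, F (e (.inr b))) ≃ Σ i, F i :=
    (Equiv.sumSigmaDistrib fun s => F (e s)).symm.trans (Equiv.sigmaCongrLeft e)
  have hcont : Continuous φ := continuous_sum_dom.2
    ⟨continuous_sigma fun a => continuous_sigmaMk (σ := F) (i := e (.inl a)),
      continuous_sigma fun b => continuous_sigmaMk (σ := F) (i := e (.inr b))⟩
  have hopen : IsOpenMap φ := isOpenMap_sum.2
    ⟨isOpenMap_sigma.2 fun a => isOpenMap_sigmaMk (σ := F) (i := e (.inl a)),
      isOpenMap_sigma.2 fun b => isOpenMap_sigmaMk (σ := F) (i := e (.inr b))⟩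
  exact ⟨(φ.toHomeomorphOfContinuousOpen hcont hopen).symm⟩

/-- `X` is the topological sum of a suborderable space and finitely many loop-ordered spaces. -/
def HasLoopDecomposition (X : Type u) [TopologicalSpace X] : Prop :=
  ∃ (S : Type u) (_ : TopologicalSpace S) (n : ℕ) (L : Fin n → Type u)
    (_ : ∀ i, TopologicalSpace (L i)),
    IsSuborderable S ∧ (∀ i, IsLoopOrdered (L i)) ∧ Nonempty (X ≃ₜ S ⊕ (Σ i, L i))

theorem HasLoopDecomposition.of_homeomorph {X Y : Type u} [TopologicalSpace X]
    [TopologicalSpace Y] (h : HasLoopDecomposition Y) (e : X ≃ₜ Y) : HasLoopDecomposition X := by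
  obtain ⟨S, _, n, L, _, hS, hL, ⟨e'⟩⟩ := h
  exact ⟨S, inferInstance, n, L, inferInstance, hS, hL, ⟨e.trans e'⟩⟩

theorem HasLoopDecomposition.sigma {ι : Type u} [Finite ι]
    {F : ι → Type u} [∀ i, TopologicalSpace (F i)]
    (hF : ∀ i, IsSuborderable (F i) ∨ IsLoopOrdered (F i)) :
    HasLoopDecomposition (Σ i, F i) := by
  classical
  obtain ⟨n, ⟨e⟩⟩ := Finite.exists_equiv_fin {i // ¬IsSuborderable (F i)}
  refine ⟨_, _, n, _, _, IsSuborderable.sigma fun i => i.2,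
    fun i => (hF _).resolve_left (e.symm i).2, nonempty_homeomorph_sum_sigma
      (((Equiv.refl _).sumCongr e.symm).trans (Equiv.sumCompl fun i => IsSuborderable (F i))) F⟩

theorem IsLocallyOrdered.hasLoopDecomposition {X Y : Type u} [TopologicalSpace X]
    [TopologicalSpace Y] [CompactSpace Y] [T2Space Y] (hY : IsLocallyOrdered Y) {f : X → Y}
    (hf : IsEmbedding f) :
    HasLoopDecomposition X := by
  choose E hclopen hmem hE using hY.exists_isClopen
  obtain ⟨t, c, hc, hcE⟩ := exists_isLocallyConstant_mem hclopen hmem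
  have hfiber (i : t) : IsSuborderable ((c ∘ f) ⁻¹' {i}) ∨ IsLoopOrdered ((c ∘ f) ⁻¹' {i}) := by
    have hmaps : ∀ x : (c ∘ f) ⁻¹' {i}, f x ∈ E i := by
      rintro ⟨x, rfl⟩
      exact hcE (f x)
    have hemb := (hf.comp IsEmbedding.subtypeVal).codRestrict (E i) hmaps
    rcases hE i with hord | ⟨p, hloop⟩
    · exact Or.inl (hord.isSuborderable.of_isEmbedding hemb)
    · exact hloop.isSuborderable_or_isLoopOrdered hemb
  obtain ⟨e⟩ := nonempty_homeomorph_sigma_fiber (hc.comp_continuous hf.continuous)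
  exact (HasLoopDecomposition.sigma hfiber).of_homeomorph e

end Decomposition

section Compactification

variable {X Y : Type u} [TopologicalSpace X] [TopologicalSpace Y]

theorem IsLocallyOrdered.exists_mem_nhds {X Y : Type*} [TopologicalSpace X] [TopologicalSpace Y]
    (h : IsLocallyOrdered X) {f : X → Y} (hf : IsOpenEmbedding f) (x : X) :
    ∃ U ∈ 𝓝 (f x), IsOrderable U := by
  obtain ⟨U, hU, hUord⟩ := h x
  exact ⟨f '' U, hf.image_mem_nhds.2 hU,
    hUord.of_homeomorph (hf.isEmbedding.homeomorphImage U).symm⟩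

theorem IsLocallyOrdered.of_homeomorph (h : IsLocallyOrdered Y) (e : X ≃ₜ Y) :
    IsLocallyOrdered X := fun x => by
  rw [← e.symm_apply_apply x]
  exact h.exists_mem_nhds e.symm.isOpenEmbedding (e x)

theorem IsLocallyOrdered.sum (hX : IsLocallyOrdered X) (hY : IsLocallyOrdered Y) :
    IsLocallyOrdered (X ⊕ Y)
  | .inl x => hX.exists_mem_nhds .inl x
  | .inr y => hY.exists_mem_nhds .inr y

theorem IsLocallyOrdered.sigma {ι : Type*} {F : ι → Type*} [∀ i, TopologicalSpace (F i)]
    (hF : ∀ i, IsLocallyOrdered (F i)) : IsLocallyOrdered (Σ i, F i) :=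
  fun ⟨i, x⟩ => (hF i).exists_mem_nhds .sigmaMk x

theorem IsOrderable.isLocallyOrdered (h : IsOrderable X) : IsLocallyOrdered X := fun _ =>
  ⟨univ, Filter.univ_mem, h.of_homeomorph (Homeomorph.Set.univ X)⟩

theorem IsLoopOrdered.compactSpace (h : IsLoopOrdered X) : CompactSpace X := by
  obtain ⟨K, _, _, _, _, _, _, ⟨e⟩⟩ := h
  exact e.symm.compactSpace

theorem IsLoopOrdered.t2Space (h : IsLoopOrdered X) : T2Space X := by
  obtain ⟨K, _, _, _, _, _, _, ⟨e⟩⟩ := h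
  obtain ⟨_⟩ := nonempty_boundedOrder (K := K)
  exact e.symm.t2Space

theorem IsLoopOrdered.isLocallyOrdered (h : IsLoopOrdered X) : IsLocallyOrdered X := by
  obtain ⟨K, _, _, _, _, _, _, ⟨e⟩⟩ := h
  obtain ⟨_⟩ := nonempty_boundedOrder (K := K)
  exact EndpointQuotient.isLocallyOrdered.of_homeomorph e

theorem isDenseEmbedding_sumMap {X Y Z W : Type*} [TopologicalSpace X] [TopologicalSpace Y]
    [TopologicalSpace Z] [TopologicalSpace W] {f : X → Y} {g : Z → W} (hf : IsDenseEmbedding f)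
    (hg : IsDenseEmbedding g) : IsDenseEmbedding (Sum.map f g) := by
  have hemb : IsEmbedding (Sum.map f g) :=
    .sumElim_of_separatedNhds (IsEmbedding.inl.comp hf.isEmbedding)
      (IsEmbedding.inr.comp hg.isEmbedding) ⟨range Sum.inl, range Sum.inr, isOpen_range_inl,
        isOpen_range_inr, range_comp_subset_range _ _, range_comp_subset_range _ _,
        isCompl_range_inl_range_inr.disjoint⟩
  refine ⟨⟨hemb.isInducing, ?_⟩, hemb.injective⟩
  rintro (y | w)
  · refine map_mem_closure continuous_inl (hf.dense y) ?_
    rintro _ ⟨x, rfl⟩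
    exact ⟨Sum.inl x, rfl⟩
  · refine map_mem_closure continuous_inr (hg.dense w) ?_
    rintro _ ⟨z, rfl⟩
    exact ⟨Sum.inr z, rfl⟩

theorem IsSuborderable.hasLocallyOrderedCompactification (h : IsSuborderable X) :
    HasLocallyOrderedCompactification X := by
  obtain ⟨K, _, hcompact, ht2, hord, f, hf⟩ := h.exists_isDenseEmbedding
  exact ⟨K, inferInstance, hcompact, ht2, hord.isLocallyOrdered, f, hf⟩

namespace HasLocallyOrderedCompactification

theorem of_isLocallyOrdered [CompactSpace X] [T2Space X] (h : IsLocallyOrdered X) :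
    HasLocallyOrderedCompactification X :=
  ⟨X, inferInstance, inferInstance, inferInstance, h, id, .id⟩

theorem of_homeomorph (h : HasLocallyOrderedCompactification Y) (e : X ≃ₜ Y) :
    HasLocallyOrderedCompactification X := by
  obtain ⟨Z, _, hcompact, ht2, hZ, f, hf⟩ := h
  have hemb := hf.isEmbedding.comp e.isEmbedding
  exact ⟨Z, inferInstance, hcompact, ht2, hZ, f ∘ e,
    ⟨hemb.isInducing, hf.dense.comp e.surjective.denseRange hf.isEmbedding.continuous⟩,
    hemb.injective⟩

theorem sum (hX : HasLocallyOrderedCompactification X)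
    (hY : HasLocallyOrderedCompactification Y) : HasLocallyOrderedCompactification (X ⊕ Y) := by
  obtain ⟨Z, _, _, _, hZ, f, hf⟩ := hX
  obtain ⟨W, _, _, _, hW, g, hg⟩ := hY
  exact ⟨Z ⊕ W, inferInstance, inferInstance, inferInstance, hZ.sum hW, Sum.map f g,
    isDenseEmbedding_sumMap hf hg⟩

end HasLocallyOrderedCompactification

theorem IsLoopOrdered.hasLocallyOrderedCompactification_sigma {ι : Type*} [Finite ι]
    {L : ι → Type*} [∀ i, TopologicalSpace (L i)] (hL : ∀ i, IsLoopOrdered (L i)) :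
    HasLocallyOrderedCompactification (Σ i, L i) := by
  have := fun i => (hL i).compactSpace
  have := fun i => (hL i).t2Space
  exact .of_isLocallyOrdered (.sigma fun i => (hL i).isLocallyOrdered)

end Compactification

theorem mainTheorem6 (X : Type u) [TopologicalSpace X] :
    HasLocallyOrderedCompactification X ↔
      ∃ (S : Type u) (_ : TopologicalSpace S) (n : ℕ) (L : Fin n → Type u)
        (_ : ∀ i, TopologicalSpace (L i)),
        IsSuborderable S ∧ (∀ i, IsLoopOrdered (L i)) ∧ Nonempty (X ≃ₜ S ⊕ (Σ i, L i)) := by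
  constructor
  · rintro ⟨Y, _, _, _, hY, f, hf⟩
    exact hY.hasLoopDecomposition hf.isEmbedding
  · rintro ⟨S, _, n, L, _, hS, hL, ⟨e⟩⟩
    have hloops := IsLoopOrdered.hasLocallyOrderedCompactification_sigma hL
    exact (hS.hasLocallyOrderedCompactification.sum hloops).of_homeomorph e
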